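/- **Theorem 3.7.** Let $\mathbb{K}$ be a field of characteristic zero, let $n\ge 1$, and let $W=W(n)$ be the Weyl algebra over $\mathbb{K}$, i.e. the associative unital algebra generated by $p_1,q_1,\dots,p_n,q_n$ with relations $p_iq_j-q_jp_i=\delta_{ij}$, $p_ip_j-p_jp_i=q_iq_j-q_jq_i=0$. It is $\mathbb{Z}_2$-graded, $W=W_{\bar 0}\oplus W_{\bar 1}$, with all $p_i,q_i$ odd. It is a Lie algebra for $[F,G]_{\mathcal L}=FG-GF$, and a Lie superalgebra for the bilinear bracket given by $[F,G]=FG-(-1)^{ab}GF$ for $F\in W_a$, $G\in W_b$. Let $[W,W]$ denote the linear span of all super brackets $[F,G]$. Consider the following linear actions of $W$ on itself, where $F\in W_a$, $G\in W_b$: $$\mathrm{ad}_{\mathcal L}(F)(G)=FG-GF,\qquad \mathrm{ad}'_{\mathcal L}(F)(G)=FG-(-1)^{a}GF,$$ $$\mathrm{ad}(F)(G)=[F,G]=FG-(-1)^{ab}GF,\qquad \mathrm{ad}'(F)(G)=FG-(-1)^{a(b+1)}GF.$$ Then $\mathrm{ad}_{\mathcal L}$ and $\mathrm{ad}'_{\mathcal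 L}$ are representations of the Lie algebra $W$, $\mathrm{ad}$ and $\mathrm{ad}'$ are representations of the Lie superalgebra $W$, and: 1. The representation $(\mathrm{ad}_{\mathcal L},W)$ of the Lie algebra $W$ is indecomposable with Jordan–Hölder series $\{0\}\subset\mathbb{K}\subset W$ (that is, $\mathbb{K}=\mathbb{K}\cdot 1$ is a subrepresentation, and $\mathbb{K}$ and $W/\mathbb{K}$ are simple), and the linear span $\mathrm{ad}_{\mathcal L}(W)(W)$ of all $\mathrm{ad}_{\mathcal L}(F)(G)$, $F,G\in W$, equals $W$. 2. The representation $(\mathrm{ad}'_{\mathcal L},W)$ of the Lie algebra $W$ is indecomposable, $[W,W]$ is a simple subrepresentation, $W/[W,W]$ is the trivial one-dimensional representation, and the linear map $\xi:W\to[W,W]$ with $\xi(F)=0$ if $F$ is even and $\xi(F)=2F$ if $F$ is odd is well defined and is a non-trivial cocycle: $\xi([F,G]_{\mathcal L})=\mathrm{ad}'_{\mathcal L}(F)(\xi(G))-\mathrm{ad}'_{\mathcal L}(G)(\xi(F))$ for all $F,G\in W$, and there is no $H\in[W,W]$ with $\xi(F)=\mathrm{ad}'_{\mathcal L}(F)(H)$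 for all $F\in W$. 3. The representation $(\mathrm{ad},[W,W])$ of the Lie superalgebra $W$ is simple. Moreover, $W=\mathbb{K}\oplus[W,W]$ as $\mathrm{ad}(W)$-modules. 4. The representation $(\mathrm{ad}',W)$ of the Lie superalgebra $W$ is simple. Here a representation is simple if it is nonzero and its only invariant subspaces (graded or not) are $0$ and itself, and indecomposable if it is nonzero and is not the direct sum of two nonzero invariant subspaces. -/

import Mathlib

/-! ### The Weyl algebra -/

/-- The defining relations of the Weyl algebra `W(n)` in the free algebra on the generators
`p_i = Sum.inl i` and `q_i = Sum.inr i`: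
`p_i q_j - q_j p_i = δ_ij`, `p_i p_j - p_j p_i = 0`, `q_i q_j - q_j q_i = 0`. -/
inductive WeylAlgebra.Rel (K : Type*) [Field K] (n : ℕ) :
    FreeAlgebra K (Fin n ⊕ Fin n) → FreeAlgebra K (Fin n ⊕ Fin n) → Prop
  | pq (i j : Fin n) : WeylAlgebra.Rel K n
      (FreeAlgebra.ι K (Sum.inl i) * FreeAlgebra.ι K (Sum.inr j)
        - FreeAlgebra.ι K (Sum.inr j) * FreeAlgebra.ι K (Sum.inl i))
      (if i = j then 1 else 0)
  | pp (i j : Fin n) : WeylAlgebra.Rel K n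
      (FreeAlgebra.ι K (Sum.inl i) * FreeAlgebra.ι K (Sum.inl j)
        - FreeAlgebra.ι K (Sum.inl j) * FreeAlgebra.ι K (Sum.inl i)) 0
  | qq (i j : Fin n) : WeylAlgebra.Rel K n
      (FreeAlgebra.ι K (Sum.inr i) * FreeAlgebra.ι K (Sum.inr j)
        - FreeAlgebra.ι K (Sum.inr j) * FreeAlgebra.ι K (Sum.inr i)) 0

/-- The Weyl algebra `W = W(n)` over `K`. -/
def WeylAlgebra (K : Type*) [Field K] (n : ℕ) : Type _ := RingQuot (WeylAlgebra.Rel K n)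

noncomputable instance WeylAlgebra.instRing (K : Type*) [Field K] (n : ℕ) :
    Ring (WeylAlgebra K n) :=
  inferInstanceAs (Ring (RingQuot (WeylAlgebra.Rel K n)))

noncomputable instance WeylAlgebra.instAlgebra (K : Type*) [Field K] (n : ℕ) :
    Algebra K (WeylAlgebra K n) :=
  inferInstanceAs (Algebra K (RingQuot (WeylAlgebra.Rel K n)))

/-- The Lie algebra structure of `W`, with the commutator bracket `⁅F, G⁆ = F * G - G * F`. -/
noncomputable instance WeylAlgebra.instLieRing (K : Type*) [Field K] (n : ℕ) :
    LieRing (WeylAlgebra K n) :=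
  LieRing.ofAssociativeRing

noncomputable instance WeylAlgebra.instLieAlgebra (K : Type*) [Field K] (n : ℕ) :
    LieAlgebra K (WeylAlgebra K n) :=
  LieAlgebra.ofAssociativeAlgebra

namespace WeylAlgebra

/-- The quotient map from the free algebra onto `W`. -/
noncomputable def mk (K : Type*) [Field K] (n : ℕ) :
    FreeAlgebra K (Fin n ⊕ Fin n) →ₐ[K] WeylAlgebra K n :=
  RingQuot.mkAlgHom K (Rel K n)

theorem mk_rel {K : Type*} [Field K] {n : ℕ} {x y : FreeAlgebra K (Fin n ⊕ Fin n)}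
    (h : Rel K n x y) : mk K n x = mk K n y :=
  RingQuot.mkAlgHom_rel K h

/-- The canonical generators: `gen K n (Sum.inl i) = p_i` and `gen K n (Sum.inr i) = q_i`. -/
noncomputable def gen (K : Type*) [Field K] (n : ℕ) (a : Fin n ⊕ Fin n) : WeylAlgebra K n :=
  mk K n (FreeAlgebra.ι K a)

/-- The subspace `𝕂 = 𝕂 · 1` of scalars in `W`. -/
noncomputable def scalars (K : Type*) [Field K] (n : ℕ) : Submodule K (WeylAlgebra K n) :=
  LinearMap.range (Algebra.linearMap K (WeylAlgebra K n))

/-! ### The `ℤ₂`-grading -/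

theorem parity_rel (K : Type*) [Field K] (n : ℕ) ⦃x y : FreeAlgebra K (Fin n ⊕ Fin n)⦄
    (h : Rel K n x y) : FreeAlgebra.lift K (fun a => -gen K n a) x =
      FreeAlgebra.lift K (fun a => -gen K n a) y := by
  have h1 := mk_rel h
  cases h with
  | pq i j =>
    have h2 : FreeAlgebra.lift K (fun a => -gen K n a)
        (if i = j then (1 : FreeAlgebra K (Fin n ⊕ Fin n)) else 0) =
        mk K n (if i = j then 1 else 0) := by
      split_ifs <;> simp
    rw [h2, ← h1]
    simp [gen]
  | pp i j => simpa [gen] using h1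
  | qq i j => simpa [gen] using h1

/-- The parity automorphism of `W`: the algebra endomorphism with `p_i ↦ -p_i`, `q_i ↦ -q_i`. -/
noncomputable def parity (K : Type*) [Field K] (n : ℕ) : WeylAlgebra K n →ₐ[K] WeylAlgebra K n :=
  RingQuot.liftAlgHom K ⟨FreeAlgebra.lift K fun a => -gen K n a, parity_rel K n⟩

theorem parity_gen (K : Type*) [Field K] (n : ℕ) (a : Fin n ⊕ Fin n) :
    parity K n (gen K n a) = -gen K n a := by
  have h : parity K n (gen K n a) = FreeAlgebra.lift K (fun a => -gen K n a) (FreeAlgebra.ι K a) :=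
    RingQuot.liftAlgHom_mkAlgHom_apply K _ (parity_rel K n) _
  rw [h, FreeAlgebra.lift_ι_apply]

/-- The homogeneous part `W_a` of `ℤ₂`-degree `a mod 2`: the elements on which the parity
automorphism acts by `(-1)^a`. Thus `part K n 0` is the even part, spanned by the products of an
even number of generators, and `part K n 1` is the odd part. -/
noncomputable def part (K : Type*) [Field K] (n a : ℕ) : Submodule K (WeylAlgebra K n) :=
  Module.End.eigenspace (parity K n).toLinearMap ((-1) ^ a)

/-- The projection of `W` onto its homogeneous part of degree `a mod 2` (in characteristic `≠ 2`),
`F ↦ (F + (-1)^a σ(F)) / 2` with `σ` the parity automorphism. -/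
noncomputable def component (K : Type*) [Field K] (n a : ℕ) :
    WeylAlgebra K n →ₗ[K] WeylAlgebra K n :=
  (2 : K)⁻¹ • (LinearMap.id + (-1 : K) ^ a • (parity K n).toLinearMap)

/-! ### The actions of `W` on itself -/

/-- The bilinear operation on `W` which is `F * G - (-1)^(e a b) G * F` for `F` homogeneous of
degree `a` and `G` homogeneous of degree `b` (with `a, b ∈ {0, 1}`). -/
noncomputable def signedCommutator (K : Type*) [Field K] (n : ℕ) (e : ℕ → ℕ → ℕ) :
    WeylAlgebra K n →ₗ[K] Module.End K (WeylAlgebra K n) :=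
  ∑ a ∈ Finset.range 2, ∑ b ∈ Finset.range 2,
    ((LinearMap.mul K (WeylAlgebra K n)).compl₁₂ (component K n a) (component K n b)
      - (-1 : K) ^ e a b •
        (LinearMap.mul K (WeylAlgebra K n)).flip.compl₁₂ (component K n a) (component K n b))

/-- The adjoint representation of the Lie algebra `W`: `F ↦ (G ↦ F * G - G * F)`. -/
noncomputable def adLie (K : Type*) [Field K] (n : ℕ) :
    WeylAlgebra K n →ₗ[K] Module.End K (WeylAlgebra K n) :=
  LinearMap.mul K (WeylAlgebra K n) - (LinearMap.mul K (WeylAlgebra K n)).flip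

/-- The twisted adjoint representation of the Lie algebra `W`:
`F * G - (-1)^a G * F` for `F ∈ W_a`, `G ∈ W`. -/
noncomputable def adLieTwisted (K : Type*) [Field K] (n : ℕ) :
    WeylAlgebra K n →ₗ[K] Module.End K (WeylAlgebra K n) :=
  signedCommutator K n fun a _ => a

/-- The adjoint representation of the Lie superalgebra `W`, that is, its super bracket:
`[F, G] = F * G - (-1)^(ab) G * F` for `F ∈ W_a`, `G ∈ W_b`. -/
noncomputable def adSuper (K : Type*) [Field K] (n : ℕ) :
    WeylAlgebra K n →ₗ[K] Module.End K (WeylAlgebra K n) :=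
  signedCommutator K n fun a b => a * b

/-- The twisted adjoint representation of the Lie superalgebra `W`:
`F * G - (-1)^(a(b+1)) G * F` for `F ∈ W_a`, `G ∈ W_b`. -/
noncomputable def adSuperTwisted (K : Type*) [Field K] (n : ℕ) :
    WeylAlgebra K n →ₗ[K] Module.End K (WeylAlgebra K n) :=
  signedCommutator K n fun a b => a * (b + 1)

/-- `[W, W]`: the linear span of all super brackets `[F, G]`. -/
noncomputable def superDerived (K : Type*) [Field K] (n : ℕ) : Submodule K (WeylAlgebra K n) :=
  Submodule.span K {H | ∃ F G : WeylAlgebra K n, H = adSuper K n F G}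

theorem component_of_mem {K : Type*} [Field K] [CharZero K] {n a : ℕ} {F : WeylAlgebra K n}
    (hF : F ∈ part K n a) (c : ℕ) : component K n c F = if Even (a + c) then F else 0 := by
  have h : parity K n F = (-1 : K) ^ a • F := Module.End.mem_eigenspace_iff.1 hF
  have h' : component K n c F = (2 : K)⁻¹ • (F + (-1 : K) ^ c • parity K n F) := rfl
  rw [h', h, smul_smul, ← pow_add, add_comm c a]
  split_ifs with hc
  · rw [hc.neg_one_pow, one_smul, ← two_smul K F, smul_smul, inv_mul_cancel₀ two_ne_zero, one_smul]
  · rw [(Nat.not_even_iff_odd.1 hc).neg_one_pow, neg_one_smul, add_neg_cancel, smul_zero]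

theorem signedCommutator_of_mem {K : Type*} [Field K] [CharZero K] {n : ℕ} (e : ℕ → ℕ → ℕ)
    {a b : ℕ} {F G : WeylAlgebra K n} (hF : F ∈ part K n a) (hG : G ∈ part K n b) :
    signedCommutator K n e F G = F * G - (-1 : K) ^ e (a % 2) (b % 2) • (G * F) := by
  have ha := Nat.mod_two_eq_zero_or_one a
  have hb := Nat.mod_two_eq_zero_or_one b
  rcases ha with ha | ha <;> rcases hb with hb | hb <;>
    simp [signedCommutator, Finset.sum_range_succ, component_of_mem hF, component_of_mem hG,
      Nat.even_iff, Nat.add_mod, ha, hb]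

end WeylAlgebra

/-! ### Representation-theoretic notions

A family of operators `ρ x`, `x ∈ L`, on a vector space `M`, depending linearly on `x`. -/

/-- `U` is a subrepresentation: a subspace stable under all `ρ x`. -/
def IsSubrep {K L M : Type*} [Field K] [AddCommGroup L] [Module K L] [AddCommGroup M] [Module K M]
    (ρ : L →ₗ[K] Module.End K M) (U : Submodule K M) : Prop :=
  ∀ x : L, ∀ m ∈ U, ρ x m ∈ U

/-- `U ⊂ V` are subrepresentations and the quotient `V / U` is a simple representation: it is
nonzero, and its only subrepresentations are the zero one and `V / U` itself. -/
def IsSimpleSubquotient {K L M : Type*} [Field K] [AddCommGroup L] [Module K L] [AddCommGroup M]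
    [Module K M] (ρ : L →ₗ[K] Module.End K M) (U V : Submodule K M) : Prop :=
  IsSubrep ρ U ∧ IsSubrep ρ V ∧ U < V ∧
    ∀ N : Submodule K M, IsSubrep ρ N → U ≤ N → N ≤ V → N = U ∨ N = V

/-- `U` is a simple subrepresentation. -/
def IsSimpleSubrep {K L M : Type*} [Field K] [AddCommGroup L] [Module K L] [AddCommGroup M]
    [Module K M] (ρ : L →ₗ[K] Module.End K M) (U : Submodule K M) : Prop :=
  IsSimpleSubquotient ρ ⊥ U

/-- The representation `M` is indecomposable: it is nonzero and is not the direct sum of two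
nonzero subrepresentations. -/
def IsIndecomposableRep {K L M : Type*} [Field K] [AddCommGroup L] [Module K L] [AddCommGroup M]
    [Module K M] (ρ : L →ₗ[K] Module.End K M) : Prop :=
  Nontrivial M ∧ ∀ U V : Submodule K M, IsSubrep ρ U → IsSubrep ρ V → IsCompl U V → U = ⊥ ∨ V = ⊥

/-- `ρ` is a representation of the Lie algebra `L`. -/
def IsLieRep {K L M : Type*} [Field K] [LieRing L] [LieAlgebra K L] [AddCommGroup M]
    [Module K M] (ρ : L →ₗ[K] Module.End K M) : Prop :=
  ∀ x y : L, ρ ⁅x, y⁆ = ρ x * ρ y - ρ y * ρ x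

/-- `ρ` is a representation of the Lie superalgebra `W` on the `ℤ₂`-graded space `W`: it is
compatible with the degrees and `ρ([F, G]) = ρ(F) ρ(G) - (-1)^(ab) ρ(G) ρ(F)` for `F ∈ W_a`,
`G ∈ W_b`, where `[F, G]` is the super bracket. -/
def WeylAlgebra.IsSuperRep {K : Type*} [Field K] {n : ℕ}
    (ρ : WeylAlgebra K n →ₗ[K] Module.End K (WeylAlgebra K n)) : Prop :=
  (∀ a b : ℕ, ∀ F ∈ part K n a, ∀ G ∈ part K n b, ρ F G ∈ part K n (a + b)) ∧
  ∀ a b : ℕ, ∀ F ∈ part K n a, ∀ G ∈ part K n b,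
    ρ (adSuper K n F G) = ρ F * ρ G - (-1 : K) ^ (a * b) • (ρ G * ρ F)

/-- A linear map `ξ : L → U` into a subrepresentation `U` of the representation `ρ` of the Lie
algebra `L` is a `1`-cocycle: `ξ([x, y]) = x · ξ(y) - y · ξ(x)`. -/
def IsLieCocycle {K L M : Type*} [Field K] [LieRing L] [LieAlgebra K L] [AddCommGroup M]
    [Module K M] (ρ : L →ₗ[K] Module.End K M) (U : Submodule K M) (ξ : L →ₗ[K] U) : Prop :=
  ∀ x y : L, (ξ ⁅x, y⁆ : M) = ρ x (ξ y) - ρ y (ξ x)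

/-- `ξ : L → U` is a `1`-coboundary: `ξ(x) = x · u` for some `u ∈ U`. -/
def IsLieCoboundary {K L M : Type*} [Field K] [LieRing L] [LieAlgebra K L] [AddCommGroup M]
    [Module K M] (ρ : L →ₗ[K] Module.End K M) (U : Submodule K M) (ξ : L →ₗ[K] U) : Prop :=
  ∃ u ∈ U, ∀ x : L, (ξ x : M) = ρ x u

/-!
The Weyl algebra `W` is compared with polynomials in the `p_i`, `q_i` through the Weyl symbol
(`symbol`): commutators with generators become derivations, and anticommutators become
multiplication by twice a variable. The symbol is injective, because its kernel is stable under
commutators with generators, these lower the filtration by word length, and the centre of `W` is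
`K` (`mem_scalars_of_adLie_gen_eq_zero`). The constant term of the symbol is a trace twisted by the
parity automorphism (`supertrace_mul`). It vanishes on `[W, W]`, and since `W = K + [W, W]`
(`codisjoint_scalars`), its kernel is `[W, W]` and `W = K ⊕ [W, W]`.

For the adjoint representation of the Lie algebra `W`, bracketing a non-scalar element of an ideal
with generators leads to an element `x` with all `[a, x]` scalar and some `[a, x] = c ≠ 0`; then
`[a ^ 2, x] = 2 c a`, so the ideal contains a generator `a`, and it is `W` because `[a, ·]` is
surjective (`exists_adLie_gen_eq`).

The other three actions restrict to the commutator on the even part of `W`, and the main point is a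
statement on a nonzero subspace `N` stable under commutators with even elements: for each `i` it
contains `1`, `p_i` or `p_i ^ 2` (`exists_pow_mem_le_two`). This is a highest weight argument. The
operator `[p_i ^ 2, ·]`, and then the operators `[p_i a, ·]` for the generators `a ≠ q_i`, are locally
nilpotent, so `N` contains a nonzero polynomial in `p_i`; since `[p_i q_i, ·]` acts on those as
`-X d/dX`, it contains a power of `p_i`. Commutators with even quartic elements and with `q_i ^ 2`
lower the exponent by `2` as long as it is at least `3` (`pow_add_one_mem`). The action of an odd
generator then puts `p_i` itself into `N`. As every odd element is the commutator of an even element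
and `p_i`, all odd elements lie in `N`, in particular all generators. The action of odd elements on
generators yields the even part of `[W, W]`, or the whole even part in the case of the twisted
action of the superalgebra.
-/

/-! ### Generators and the filtration by word length -/

namespace WeylAlgebra

variable {K : Type*} [Field K] {n : ℕ}

theorem adLie_apply (F G : WeylAlgebra K n) : adLie K n F G = F * G - G * F := rfl

/-- The standard symplectic form on the span of the generators: the commutator of two generators
is this scalar, see `adLie_gen_gen`. -/
def symplecticForm (K : Type*) [Field K] (n : ℕ) : Fin n ⊕ Fin n → Fin n ⊕ Fin n → K
  | Sum.inl i, Sum.inr j => if i = j then 1 else 0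
  | Sum.inr i, Sum.inl j => if i = j then -1 else 0
  | _, _ => 0

theorem symplecticForm_swap (a b : Fin n ⊕ Fin n) :
    symplecticForm K n b a = -symplecticForm K n a b := by
  rcases a with i | i <;> rcases b with j | j <;> simp [symplecticForm, eq_comm]
  all_goals split_ifs <;> simp

theorem adLie_gen_gen (a b : Fin n ⊕ Fin n) :
    adLie K n (gen K n a) (gen K n b) = algebraMap K _ (symplecticForm K n a b) := by
  have key : ∀ i j : Fin n, adLie K n (gen K n (Sum.inl i)) (gen K n (Sum.inr j)) =
      if i = j then 1 else 0 := by
    intro i j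
    have h := mk_rel (Rel.pq (K := K) i j)
    rw [map_sub, map_mul, map_mul] at h
    rw [adLie_apply]
    refine h.trans ?_
    split_ifs <;> simp
  rcases a with i | i <;> rcases b with j | j
  · simpa [symplecticForm, adLie_apply, gen] using mk_rel (Rel.pp (K := K) i j)
  · rw [key]
    simp only [symplecticForm]
    split_ifs <;> simp
  · have h := key j i
    rw [adLie_apply] at h ⊢
    rw [← neg_sub, h]
    simp only [symplecticForm, eq_comm]
    split_ifs <;> simp
  · simpa [symplecticForm, adLie_apply, gen] using mk_rel (Rel.qq (K := K) i j)

theorem adLie_algebraMap (F : WeylAlgebra K n) (c : K) :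
    adLie K n F (algebraMap K _ c) = 0 := by
  rw [adLie_apply, Algebra.commutes, sub_self]

theorem adLie_mul (F G H : WeylAlgebra K n) :
    adLie K n F (G * H) = adLie K n F G * H + G * adLie K n F H := by
  simp only [adLie_apply]
  noncomm_ring

theorem adLie_gen_comm (a b : Fin n ⊕ Fin n) (x : WeylAlgebra K n) :
    adLie K n (gen K n a) (adLie K n (gen K n b) x) =
      adLie K n (gen K n b) (adLie K n (gen K n a) x) := by
  have h := adLie_algebraMap x (symplecticForm K n a b)
  rw [← adLie_gen_gen] at h
  simp only [adLie_apply] at h ⊢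
  rw [← sub_eq_zero, ← neg_eq_zero, ← h]
  noncomm_ring

theorem mul_gen (a b : Fin n ⊕ Fin n) : gen K n a * gen K n b =
    gen K n b * gen K n a + algebraMap K _ (symplecticForm K n a b) := by
  rw [← adLie_gen_gen, adLie_apply]
  abel

/-- Every generator has a conjugate, which is another generator up to sign. -/
theorem exists_conjugate (a : Fin n ⊕ Fin n) :
    ∃ (b : Fin n ⊕ Fin n) (c : K), adLie K n (gen K n a) (c • gen K n b) = 1 := by
  rcases a with i | i
  · exact ⟨Sum.inr i, 1, by simp [adLie_gen_gen, symplecticForm]⟩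
  · exact ⟨Sum.inl i, -1, by simp [adLie_gen_gen, symplecticForm]⟩

protected theorem induction {P : WeylAlgebra K n → Prop}
    (algebraMap : ∀ c : K, P (algebraMap K _ c)) (gen : ∀ a, P (gen K n a)) (mul : ∀ x y, P x → P y → P (x * y))
    (add : ∀ x y, P x → P y → P (x + y)) (x : WeylAlgebra K n) : P x := by
  obtain ⟨y, rfl⟩ : ∃ y, mk K n y = x := RingQuot.mkAlgHom_surjective K (Rel K n) x
  induction y using FreeAlgebra.induction with
  | grade0 r => rw [AlgHom.commutes]; exact algebraMap r
  | grade1 a => exact gen a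
  | mul a b ha hb => rw [map_mul]; exact mul _ _ ha hb
  | add a b ha hb => rw [map_add]; exact add _ _ ha hb

/-- The subspace spanned by the products of at most `d` generators. -/
noncomputable def filtration (K : Type*) [Field K] (n d : ℕ) : Submodule K (WeylAlgebra K n) :=
  (1 ⊔ Submodule.span K (Set.range (gen K n))) ^ d

theorem filtration_zero : filtration K n 0 = scalars K n := by
  rw [filtration, pow_zero, Submodule.one_eq_range, scalars]

theorem filtration_mono {d e : ℕ} (h : d ≤ e) : filtration K n d ≤ filtration K n e :=
  pow_le_pow_right₀ (le_sup_left : (1 : Submodule K (WeylAlgebra K n)) ≤ _) h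

theorem gen_mem_filtration (a : Fin n ⊕ Fin n) : gen K n a ∈ filtration K n 1 := by
  rw [filtration, pow_one]
  exact Submodule.mem_sup_right (Submodule.subset_span ⟨a, rfl⟩)

theorem mul_mem_filtration {d e : ℕ} {x y : WeylAlgebra K n} (hx : x ∈ filtration K n d)
    (hy : y ∈ filtration K n e) : x * y ∈ filtration K n (d + e) := by
  rw [filtration, pow_add]
  exact Submodule.mul_mem_mul hx hy

theorem gen_mul_mem_filtration {d : ℕ} (a : Fin n ⊕ Fin n) {x : WeylAlgebra K n}
    (hx : x ∈ filtration K n d) : gen K n a * x ∈ filtration K n (d + 1) := by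
  rw [add_comm]
  exact mul_mem_filtration (gen_mem_filtration a) hx

theorem exists_mem_filtration (x : WeylAlgebra K n) : ∃ d, x ∈ filtration K n d := by
  induction x using WeylAlgebra.induction with
  | algebraMap c => exact ⟨0, by rw [filtration_zero]; exact ⟨c, rfl⟩⟩
  | gen a => exact ⟨1, gen_mem_filtration a⟩
  | mul x y hx hy =>
    obtain ⟨d, hd⟩ := hx
    obtain ⟨e, he⟩ := hy
    exact ⟨d + e, mul_mem_filtration hd he⟩
  | add x y hx hy =>
    obtain ⟨d, hd⟩ := hx
    obtain ⟨e, he⟩ := hy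
    exact ⟨d + e, add_mem (filtration_mono (Nat.le_add_right d e) hd)
      (filtration_mono (Nat.le_add_left e d) he)⟩

theorem filtration_succ_le {d : ℕ} {N : Submodule K (WeylAlgebra K n)}
    (h : filtration K n d ≤ N) (hg : ∀ a, ∀ x ∈ filtration K n d, gen K n a * x ∈ N) :
    filtration K n (d + 1) ≤ N := by
  rw [filtration, pow_succ', Submodule.sup_mul, one_mul]
  refine sup_le h (Submodule.mul_le.2 fun v hv y hy => ?_)
  induction hv using Submodule.span_induction with
  | mem v hv => obtain ⟨a, rfl⟩ := hv; exact hg a y hy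
  | zero => rw [zero_mul]; exact N.zero_mem
  | add v w _ _ hv hw => rw [add_mul]; exact add_mem hv hw
  | smul c v _ hv => rw [smul_mul_assoc]; exact N.smul_mem c hv

theorem adLie_eq_zero_of_mem_scalars (F : WeylAlgebra K n) {x : WeylAlgebra K n}
    (hx : x ∈ scalars K n) : adLie K n F x = 0 := by
  obtain ⟨c, rfl⟩ := hx
  exact adLie_algebraMap F c

theorem adLie_gen_mem_filtration {d : ℕ} (a : Fin n ⊕ Fin n) {x : WeylAlgebra K n}
    (hx : x ∈ filtration K n (d + 1)) : adLie K n (gen K n a) x ∈ filtration K n d := by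
  induction d generalizing x with
  | zero =>
    refine filtration_succ_le (N := (filtration K n 0).comap (adLie K n (gen K n a)))
      (fun y hy => ?_) (fun b y hy => ?_) hx
    · rw [filtration_zero] at hy
      simp [adLie_eq_zero_of_mem_scalars _ hy]
    · have hy' := hy
      rw [filtration_zero] at hy'
      rw [Submodule.mem_comap, adLie_mul, adLie_gen_gen, adLie_eq_zero_of_mem_scalars _ hy',
        mul_zero, add_zero, ← Algebra.smul_def]
      exact Submodule.smul_mem _ _ hy
  | succ d ih =>
    refine filtration_succ_le (N := (filtration K n (d + 1)).comap (adLie K n (gen K n a)))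
      (fun y hy => ?_) (fun b y hy => ?_) hx
    · exact filtration_mono (Nat.le_succ d) (ih hy)
    · rw [Submodule.mem_comap, adLie_mul, adLie_gen_gen, ← Algebra.smul_def]
      exact add_mem (Submodule.smul_mem _ _ hy) (gen_mul_mem_filtration b (ih hy))

theorem adLie_gen_pow_eq_zero {d : ℕ} (a : Fin n ⊕ Fin n) {x : WeylAlgebra K n}
    (hx : x ∈ filtration K n d) : (adLie K n (gen K n a) ^ (d + 1)) x = 0 := by
  induction d generalizing x with
  | zero =>
    rw [filtration_zero] at hx
    rw [zero_add, pow_one, adLie_eq_zero_of_mem_scalars _ hx]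
  | succ d ih => rw [pow_succ, Module.End.mul_apply, ih (adLie_gen_mem_filtration a hx)]

/-! ### The centre -/

/-- The operator `∑ i, q_i [p_i, ·] - p_i [q_i, ·]`, which multiplies a product of `d` generators
by `d` up to shorter products. -/
noncomputable def eulerOperator (K : Type*) [Field K] (n : ℕ) : Module.End K (WeylAlgebra K n) :=
  ∑ i : Fin n, (LinearMap.mulLeft K (gen K n (Sum.inr i)) ∘ₗ adLie K n (gen K n (Sum.inl i))
    - LinearMap.mulLeft K (gen K n (Sum.inl i)) ∘ₗ adLie K n (gen K n (Sum.inr i)))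

theorem eulerOperator_apply (x : WeylAlgebra K n) : eulerOperator K n x =
    ∑ i : Fin n, (gen K n (Sum.inr i) * adLie K n (gen K n (Sum.inl i)) x
      - gen K n (Sum.inl i) * adLie K n (gen K n (Sum.inr i)) x) := by
  simp [eulerOperator]

theorem eulerOperator_gen (a : Fin n ⊕ Fin n) :
    eulerOperator K n (gen K n a) = gen K n a := by
  rw [eulerOperator_apply]
  rcases a with j | j <;> simp [adLie_gen_gen, symplecticForm, apply_ite (algebraMap K _)]

theorem eulerOperator_gen_mul (a : Fin n ⊕ Fin n) (x : WeylAlgebra K n) :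
    eulerOperator K n (gen K n a * x) = gen K n a * x + gen K n a * eulerOperator K n x +
      ∑ i : Fin n, (symplecticForm K n (Sum.inr i) a • adLie K n (gen K n (Sum.inl i)) x
        - symplecticForm K n (Sum.inl i) a • adLie K n (gen K n (Sum.inr i)) x) := by
  conv_rhs => enter [1, 1]; rw [← eulerOperator_gen a]
  simp only [eulerOperator_apply, Finset.sum_mul, Finset.mul_sum, ← Finset.sum_add_distrib]
  refine Finset.sum_congr rfl fun i _ => ?_
  simp only [adLie_mul, Algebra.smul_def, mul_add, ← mul_assoc, mul_gen _ a, add_mul, sub_mul,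
    mul_sub]
  abel

theorem eulerOperator_sub_mem (d : ℕ) {x : WeylAlgebra K n} (hx : x ∈ filtration K n (d + 1)) :
    eulerOperator K n x - (d + 1 : K) • x ∈ filtration K n d := by
  have hlow : ∀ e, ∀ a, ∀ y ∈ filtration K n e, ∑ i : Fin n,
      (symplecticForm K n (Sum.inr i) a • adLie K n (gen K n (Sum.inl i)) y
        - symplecticForm K n (Sum.inl i) a • adLie K n (gen K n (Sum.inr i)) y) ∈
      filtration K n e := fun e a y hy =>
    Submodule.sum_mem _ fun i _ => sub_mem
      (Submodule.smul_mem _ _ (adLie_gen_mem_filtration _ (filtration_mono (Nat.le_succ e) hy)))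
      (Submodule.smul_mem _ _ (adLie_gen_mem_filtration _ (filtration_mono (Nat.le_succ e) hy)))
  induction d generalizing x with
  | zero =>
    refine filtration_succ_le (N := (filtration K n 0).comap
      (eulerOperator K n - (((0 : ℕ) : K) + 1) • LinearMap.id)) (fun y hy => ?_) (fun b y hy => ?_) hx
    all_goals
      have hy0 : eulerOperator K n y = 0 := by
        rw [filtration_zero] at hy
        simp [eulerOperator_apply, adLie_eq_zero_of_mem_scalars _ hy]
    · simpa [hy0] using hy
    · simpa [eulerOperator_gen_mul, hy0] using hlow 0 b y hy
  | succ d ih =>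
    refine filtration_succ_le (N := (filtration K n (d + 1)).comap
      (eulerOperator K n - (((d + 1 : ℕ) : K) + 1) • LinearMap.id)) (fun y hy => ?_)
      (fun b y hy => ?_) hx
    · have h := add_mem (filtration_mono (Nat.le_succ d) (ih hy)) (Submodule.smul_mem _ (-1 : K) hy)
      rw [Submodule.mem_comap]
      convert h using 1
      simp only [LinearMap.sub_apply, LinearMap.smul_apply, LinearMap.id_apply]
      push_cast
      module
    · have h := add_mem (gen_mul_mem_filtration b (ih hy)) (hlow (d + 1) b y hy)
      rw [Submodule.mem_comap]
      convert h using 1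
      simp only [LinearMap.sub_apply, LinearMap.smul_apply, LinearMap.id_apply,
        eulerOperator_gen_mul, mul_sub, mul_smul_comm]
      push_cast
      module

/-- The centre of the Weyl algebra consists of scalars: the Euler operator annihilates a central
element, so its leading part has degree `0`. -/
theorem mem_scalars_of_adLie_gen_eq_zero [CharZero K] {x : WeylAlgebra K n}
    (h : ∀ a, adLie K n (gen K n a) x = 0) : x ∈ scalars K n := by
  obtain ⟨d, hd⟩ := exists_mem_filtration x
  induction d with
  | zero => rwa [filtration_zero] at hd
  | succ d ih =>
    refine ih ?_
    have h' := eulerOperator_sub_mem d hd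
    rw [eulerOperator_apply] at h'
    simp only [h, mul_zero, sub_zero, Finset.sum_const_zero, zero_sub] at h'
    rw [neg_mem_iff] at h'
    exact (Submodule.smul_mem_iff _ (Nat.cast_add_one_ne_zero d)).1 h'

/-! ### The Weyl symbol -/

/-- The Hamiltonian derivation of the polynomial ring attached to the variable `X a`, with
`X b ↦ symplecticForm K n a b`. -/
noncomputable def hamiltonian (K : Type*) [Field K] (n : ℕ) (a : Fin n ⊕ Fin n) :
    Derivation K (MvPolynomial (Fin n ⊕ Fin n) K) (MvPolynomial (Fin n ⊕ Fin n) K) :=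
  MvPolynomial.mkDerivation K fun b => MvPolynomial.C (symplecticForm K n a b)

theorem hamiltonian_X (a b : Fin n ⊕ Fin n) : hamiltonian K n a (MvPolynomial.X b) =
    MvPolynomial.C (symplecticForm K n a b) :=
  MvPolynomial.mkDerivation_X K _ b

theorem hamiltonian_comm (a b : Fin n ⊕ Fin n) (f : MvPolynomial (Fin n ⊕ Fin n) K) :
    hamiltonian K n a (hamiltonian K n b f) = hamiltonian K n b (hamiltonian K n a f) := by
  have h : ⁅hamiltonian K n a, hamiltonian K n b⁆ = 0 :=
    MvPolynomial.derivation_ext fun c => by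
      simp [Derivation.commutator_apply, hamiltonian_X]
  have h' := DFunLike.congr_fun h f
  rwa [Derivation.commutator_apply, Derivation.zero_apply, sub_eq_zero] at h'

/-- The operator `X_a + (ε / 2) {X_a, ·}` on polynomials. For `ε = 1` it is Moyal multiplication by
`X_a` on the left, and for `ε = -1` on the right. -/
noncomputable def moyalOp (K : Type*) [Field K] (n : ℕ) (ε : K) (a : Fin n ⊕ Fin n) :
    Module.End K (MvPolynomial (Fin n ⊕ Fin n) K) :=
  LinearMap.mulLeft K (MvPolynomial.X a) + (ε / 2) • (hamiltonian K n a).toLinearMap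

theorem moyalOp_apply (ε : K) (a : Fin n ⊕ Fin n) (f : MvPolynomial (Fin n ⊕ Fin n) K) :
    moyalOp K n ε a f = MvPolynomial.X a * f + (ε / 2) • hamiltonian K n a f := rfl

theorem moyalOp_commutator (ε ε' : K) (a b : Fin n ⊕ Fin n) :
    moyalOp K n ε a * moyalOp K n ε' b - moyalOp K n ε' b * moyalOp K n ε a =
      algebraMap K _ ((ε + ε') / 2 * symplecticForm K n a b) := by
  refine LinearMap.ext fun f => ?_
  simp only [LinearMap.sub_apply, Module.End.mul_apply, moyalOp_apply, map_add,
    Derivation.map_smul, Derivation.leibniz, hamiltonian_X, hamiltonian_comm b a,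
    Module.algebraMap_end_apply, symplecticForm_swap a b, smul_eq_mul]
  simp only [MvPolynomial.smul_eq_C_mul, map_mul, map_neg, map_add, add_div]
  ring

theorem moyalRep_rel [CharZero K] ⦃x y : FreeAlgebra K (Fin n ⊕ Fin n)⦄ (h : Rel K n x y) :
    FreeAlgebra.lift K (moyalOp K n 1) x = FreeAlgebra.lift K (moyalOp K n 1) y := by
  have h2 : ((1 : K) + 1) / 2 = 1 := by norm_num
  cases h with
  | pq i j =>
    simp only [map_sub, map_mul, FreeAlgebra.lift_ι_apply, moyalOp_commutator, symplecticForm, h2]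
    split_ifs <;> simp
  | pp i j =>
    simp [FreeAlgebra.lift_ι_apply, moyalOp_commutator, symplecticForm]
  | qq i j =>
    simp [FreeAlgebra.lift_ι_apply, moyalOp_commutator, symplecticForm]

/-- The left regular representation of the Weyl algebra in terms of Weyl symbols: the generators
act on polynomials by left Moyal multiplication. -/
noncomputable def moyalRep (K : Type*) [Field K] [CharZero K] (n : ℕ) :
    WeylAlgebra K n →ₐ[K] Module.End K (MvPolynomial (Fin n ⊕ Fin n) K) :=
  RingQuot.liftAlgHom K ⟨FreeAlgebra.lift K (moyalOp K n 1), fun _ _ h => moyalRep_rel h⟩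

theorem moyalRep_gen [CharZero K] (a : Fin n ⊕ Fin n) :
    moyalRep K n (gen K n a) = moyalOp K n 1 a := by
  have h : moyalRep K n (gen K n a) =
      FreeAlgebra.lift K (moyalOp K n 1) (FreeAlgebra.ι K a) :=
    RingQuot.liftAlgHom_mkAlgHom_apply K _ (fun _ _ h => moyalRep_rel h) _
  rw [h, FreeAlgebra.lift_ι_apply]

/-- The Weyl symbol of an element of the Weyl algebra. -/
noncomputable def symbol (K : Type*) [Field K] [CharZero K] (n : ℕ) :
    WeylAlgebra K n →ₗ[K] MvPolynomial (Fin n ⊕ Fin n) K :=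
  (LinearMap.applyₗ (1 : MvPolynomial (Fin n ⊕ Fin n) K)) ∘ₗ (moyalRep K n).toLinearMap

theorem symbol_apply [CharZero K] (x : WeylAlgebra K n) : symbol K n x = moyalRep K n x 1 := rfl

theorem symbol_algebraMap [CharZero K] (c : K) :
    symbol K n (algebraMap K _ c) = MvPolynomial.C c := by
  rw [symbol_apply, AlgHom.commutes, Module.algebraMap_end_apply, MvPolynomial.smul_eq_C_mul,
    mul_one]

theorem symbol_gen_mul [CharZero K] (a : Fin n ⊕ Fin n) (x : WeylAlgebra K n) :
    symbol K n (gen K n a * x) = moyalOp K n 1 a (symbol K n x) := by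
  rw [symbol_apply, map_mul, moyalRep_gen, Module.End.mul_apply, ← symbol_apply]

theorem symbol_mul_gen [CharZero K] (a : Fin n ⊕ Fin n) (x : WeylAlgebra K n) :
    symbol K n (x * gen K n a) = moyalOp K n (-1) a (symbol K n x) := by
  -- right Moyal multiplication commutes with the whole left regular representation
  have hcomm : ∀ x : WeylAlgebra K n,
      Commute (moyalRep K n x) (moyalOp K n (-1) a) := by
    intro x
    induction x using WeylAlgebra.induction with
    | algebraMap c => rw [AlgHom.commutes]; exact Algebra.commutes c _
    | gen b =>
      rw [moyalRep_gen]
      refine sub_eq_zero.1 ?_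
      rw [moyalOp_commutator]
      simp
    | mul x y hx hy => rw [map_mul]; exact hx.mul_left hy
    | add x y hx hy => rw [map_add]; exact hx.add_left hy
  rw [symbol_apply, map_mul, moyalRep_gen, symbol_apply, ← Module.End.mul_apply (moyalOp K n (-1) a),
    ← (hcomm x).eq, Module.End.mul_apply, Module.End.mul_apply]
  simp [moyalOp_apply]

theorem symbol_gen_mul_add_mul_gen [CharZero K] (a : Fin n ⊕ Fin n) (x : WeylAlgebra K n) :
    symbol K n (gen K n a * x + x * gen K n a) = 2 * MvPolynomial.X a * symbol K n x := by
  rw [map_add, symbol_gen_mul, symbol_mul_gen, moyalOp_apply, moyalOp_apply, neg_div, neg_smul]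
  ring

theorem symbol_adLie_gen [CharZero K] (a : Fin n ⊕ Fin n) (x : WeylAlgebra K n) :
    symbol K n (adLie K n (gen K n a) x) = hamiltonian K n a (symbol K n x) := by
  rw [adLie_apply, map_sub, symbol_gen_mul, symbol_mul_gen, moyalOp_apply, moyalOp_apply, neg_div,
    neg_smul, add_sub_add_left_eq_sub, sub_neg_eq_add, ← add_smul]
  norm_num

theorem symbol_injective [CharZero K] : Function.Injective (symbol K n) := by
  rw [injective_iff_map_eq_zero]
  intro x hx
  obtain ⟨d, hd⟩ := exists_mem_filtration x
  -- the kernel is stable under the derivations `[gen a, ·]`, which lower the filtration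
  have hscal : ∀ y ∈ scalars K n, symbol K n y = 0 → y = 0 := by
    rintro _ ⟨c, rfl⟩ hc
    rw [Algebra.linearMap_apply, symbol_algebraMap,
      map_eq_zero_iff _ (MvPolynomial.C_injective _ _)] at hc
    simp [hc]
  induction d generalizing x with
  | zero => exact hscal x (by rwa [filtration_zero] at hd) hx
  | succ d ih =>
    refine hscal x (mem_scalars_of_adLie_gen_eq_zero fun a => ?_) hx
    exact ih _ (by rw [symbol_adLie_gen, hx, map_zero]) (adLie_gen_mem_filtration a hd)

theorem eq_zero_of_gen_mul_add_mul_gen_eq_zero [CharZero K] (a : Fin n ⊕ Fin n)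
    {x : WeylAlgebra K n} (h : gen K n a * x + x * gen K n a = 0) : x = 0 := by
  refine symbol_injective ?_
  have h' := symbol_gen_mul_add_mul_gen a x
  rw [h, map_zero, eq_comm, mul_assoc, mul_eq_zero, mul_eq_zero] at h'
  rw [map_zero]
  exact (h'.resolve_left two_ne_zero).resolve_left (MvPolynomial.X_ne_zero a)

theorem algebraMap_injective [CharZero K] :
    Function.Injective (algebraMap K (WeylAlgebra K n)) := fun c d h =>
  MvPolynomial.C_injective _ _ (by rw [← symbol_algebraMap, h, symbol_algebraMap])

instance [CharZero K] : Nontrivial (WeylAlgebra K n) :=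
  ⟨⟨1, 0, fun h => one_ne_zero (α := K) (algebraMap_injective (n := n) (by simpa using h))⟩⟩

theorem gen_notMem_scalars [CharZero K] (a : Fin n ⊕ Fin n) : gen K n a ∉ scalars K n := by
  intro ha
  obtain ⟨b, c, h⟩ := exists_conjugate (K := K) a
  rw [adLie_apply, ← neg_sub, ← adLie_apply, adLie_eq_zero_of_mem_scalars _ ha, neg_zero] at h
  exact zero_ne_one h

/-! ### Parity and the supertrace -/

theorem parity_parity (x : WeylAlgebra K n) : parity K n (parity K n x) = x := by
  induction x using WeylAlgebra.induction with
  | algebraMap c => simp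
  | gen a => simp [parity_gen]
  | mul x y hx hy => simp [hx, hy]
  | add x y hx hy => simp [hx, hy]

/-- The supertrace of an element is the constant term of its Weyl symbol. -/
noncomputable def supertrace (K : Type*) [Field K] [CharZero K] (n : ℕ) : WeylAlgebra K n →ₗ[K] K :=
  (MvPolynomial.aeval (0 : Fin n ⊕ Fin n → K)).toLinearMap ∘ₗ symbol K n

theorem supertrace_apply [CharZero K] (x : WeylAlgebra K n) :
    supertrace K n x = MvPolynomial.aeval (0 : Fin n ⊕ Fin n → K) (symbol K n x) := rfl

theorem supertrace_algebraMap [CharZero K] (c : K) : supertrace K n (algebraMap K _ c) = c := by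
  rw [supertrace_apply, symbol_algebraMap]
  simp

/-- The supertrace is a trace twisted by the parity automorphism. For a generator this holds since
the symbol of `gen a * x + x * gen a` is divisible by `X a`. -/
theorem supertrace_mul [CharZero K] (F G : WeylAlgebra K n) :
    supertrace K n (F * G) = supertrace K n (G * parity K n F) := by
  induction F using WeylAlgebra.induction generalizing G with
  | algebraMap c => rw [AlgHom.commutes, Algebra.commutes]
  | gen a =>
    have h : supertrace K n (gen K n a * G + G * gen K n a) = 0 := by
      rw [supertrace_apply, symbol_gen_mul_add_mul_gen]
      simp
    rw [map_add] at h
    rw [parity_gen, mul_neg, map_neg]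
    exact eq_neg_of_add_eq_zero_left h
  | mul x y hx hy => rw [mul_assoc, hx, mul_assoc, hy, map_mul (parity K n), mul_assoc]
  | add x y hx hy => rw [add_mul, map_add, hx, hy, map_add, mul_add, map_add]

theorem mem_part_zero {x : WeylAlgebra K n} : x ∈ part K n 0 ↔ parity K n x = x := by
  rw [part, Module.End.mem_eigenspace_iff]
  simp

theorem mem_part_one {x : WeylAlgebra K n} : x ∈ part K n 1 ↔ parity K n x = -x := by
  rw [part, Module.End.mem_eigenspace_iff]
  simp

theorem part_eq (a : ℕ) : part K n a = part K n 0 ∧ (-1 : K) ^ a = 1 ∨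
    part K n a = part K n 1 ∧ (-1 : K) ^ a = -1 := by
  rcases neg_one_pow_eq_or K a with h | h
  · exact Or.inl ⟨by simp [part, h], h⟩
  · exact Or.inr ⟨by simp [part, h], h⟩

theorem gen_mem_part_one (a : Fin n ⊕ Fin n) : gen K n a ∈ part K n 1 :=
  mem_part_one.2 (parity_gen K n a)

theorem exists_add_mem_part [CharZero K] (x : WeylAlgebra K n) :
    ∃ y ∈ part K n 0, ∃ z ∈ part K n 1, y + z = x := by
  refine ⟨(2 : K)⁻¹ • (x + parity K n x), mem_part_zero.2 ?_,
    (2 : K)⁻¹ • (x - parity K n x), mem_part_one.2 ?_, ?_⟩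
  · rw [map_smul, map_add, parity_parity, add_comm]
  · rw [map_smul, map_sub, parity_parity, ← smul_neg, neg_sub]
  · rw [← smul_add, add_add_sub_cancel, ← two_smul K x, smul_smul, inv_mul_cancel₀ two_ne_zero,
      one_smul]

theorem disjoint_part [CharZero K] {x : WeylAlgebra K n} (h0 : x ∈ part K n 0)
    (h1 : x ∈ part K n 1) : x = 0 := by
  rw [mem_part_zero] at h0
  rw [mem_part_one, h0] at h1
  have h : (2 : K) • x = 0 := by
    rw [two_smul]
    exact add_eq_zero_iff_eq_neg.2 h1
  exact (smul_eq_zero.1 h).resolve_left two_ne_zero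

theorem supertrace_of_mem_part_one [CharZero K] {x : WeylAlgebra K n} (hx : x ∈ part K n 1) :
    supertrace K n x = 0 := by
  have h := supertrace_mul x 1
  rw [mul_one, one_mul, mem_part_one.1 hx, map_neg] at h
  exact self_eq_neg.1 h

/-! ### Surjectivity of the derivation attached to a generator -/

theorem exists_adLie_gen_eq [CharZero K] (a : Fin n ⊕ Fin n) (x : WeylAlgebra K n) :
    ∃ y, adLie K n (gen K n a) y = x := by
  obtain ⟨b, c, h⟩ := exists_conjugate (K := K) a
  set q := c • gen K n b with hq
  have hpow : ∀ j : ℕ, adLie K n (gen K n a) (q ^ (j + 1)) = ((j : K) + 1) • q ^ j := by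
    intro j
    induction j with
    | zero => simp [h]
    | succ j ih =>
      rw [pow_succ, adLie_mul, ih, h, mul_one, smul_mul_assoc, ← pow_succ]
      push_cast
      module
  -- integration by parts
  have key : ∀ m (z : WeylAlgebra K n), (adLie K n (gen K n a) ^ m) z = 0 →
      ∀ j, q ^ j * z ∈ LinearMap.range (adLie K n (gen K n a)) := by
    intro m
    induction m with
    | zero =>
      intro z hz j
      rw [pow_zero, Module.End.one_apply] at hz
      rw [hz, mul_zero]
      exact zero_mem _
    | succ m ih =>
      intro z hz j
      rw [pow_succ, Module.End.mul_apply] at hz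
      have h1 : adLie K n (gen K n a) (q ^ (j + 1) * z) ∈
        LinearMap.range (adLie K n (gen K n a)) := ⟨_, rfl⟩
      rw [adLie_mul, hpow, smul_mul_assoc] at h1
      exact (Submodule.smul_mem_iff _ (Nat.cast_add_one_ne_zero j)).1
        ((Submodule.add_mem_iff_left _ (ih _ hz (j + 1))).1 h1)
  obtain ⟨d, hd⟩ := exists_mem_filtration x
  have h1 := key (d + 1) x (adLie_gen_pow_eq_zero a hd) 0
  rw [pow_zero, one_mul] at h1
  exact h1

theorem adLie_gen_mem_part (a : Fin n ⊕ Fin n) {x : WeylAlgebra K n} :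
    (x ∈ part K n 0 → adLie K n (gen K n a) x ∈ part K n 1) ∧
      (x ∈ part K n 1 → adLie K n (gen K n a) x ∈ part K n 0) := by
  simp only [mem_part_zero, mem_part_one, adLie_apply, map_sub, map_mul, parity_gen]
  constructor <;> intro h <;> rw [h] <;> noncomm_ring

theorem exists_even_adLie_gen_eq [CharZero K] (a : Fin n ⊕ Fin n) {x : WeylAlgebra K n}
    (hx : x ∈ part K n 1) : ∃ y ∈ part K n 0, adLie K n (gen K n a) y = x := by
  obtain ⟨y, rfl⟩ := exists_adLie_gen_eq a x
  obtain ⟨y0, h0, y1, h1, rfl⟩ := exists_add_mem_part y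
  refine ⟨y0, h0, ?_⟩
  have h := (adLie_gen_mem_part a).2 h1
  have h' := sub_mem hx ((adLie_gen_mem_part a).1 h0)
  rw [map_add] at h' ⊢
  rw [add_sub_cancel_left] at h'
  rw [disjoint_part h h', add_zero]

theorem exists_odd_adLie_gen_eq [CharZero K] (a : Fin n ⊕ Fin n) {x : WeylAlgebra K n}
    (hx : x ∈ part K n 0) : ∃ y ∈ part K n 1, adLie K n (gen K n a) y = x := by
  obtain ⟨y, rfl⟩ := exists_adLie_gen_eq a x
  obtain ⟨y0, h0, y1, h1, rfl⟩ := exists_add_mem_part y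
  refine ⟨y1, h1, ?_⟩
  have h := (adLie_gen_mem_part a).1 h0
  have h' := sub_mem hx ((adLie_gen_mem_part a).2 h1)
  rw [map_add] at h' ⊢
  rw [add_sub_cancel_right] at h'
  rw [disjoint_part h' h, zero_add]

/-! ### Subspaces stable under commutators with even elements -/

theorem adLie_mul_left (F G x : WeylAlgebra K n) :
    adLie K n (F * G) x = F * adLie K n G x + adLie K n F x * G := by
  simp only [adLie_apply]
  noncomm_ring

theorem gen_mul_gen_mem_part_zero (a b : Fin n ⊕ Fin n) :
    gen K n a * gen K n b ∈ part K n 0 := by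
  simp [mem_part_zero, parity_gen]

theorem exists_mem_ker_of_pow_apply_eq_zero {M : Type*} [AddCommGroup M] [Module K M]
    {S : Submodule K M} {T : Module.End K M} (hT : ∀ x ∈ S, T x ∈ S) (m : ℕ) :
    ∀ x ∈ S, x ≠ 0 → (T ^ m) x = 0 → ∃ y ∈ S, y ≠ 0 ∧ T y = 0 := by
  induction m with
  | zero => exact fun x _ h0 h => absurd h h0
  | succ m ih =>
    intro x hx h0 h
    by_cases hTx : T x = 0
    · exact ⟨x, hx, h0, hTx⟩
    · exact ih (T x) (hT x hx) hTx (by rwa [pow_succ, Module.End.mul_apply] at h)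

/-- The operator `[p_i ^ 2, ·]` is locally nilpotent and has the same kernel as `[p_i, ·]`. -/
theorem exists_mem_adLie_inl_eq_zero [CharZero K] {N : Submodule K (WeylAlgebra K n)}
    (hN : ∀ F ∈ part K n 0, ∀ x ∈ N, adLie K n F x ∈ N) (h0 : N ≠ ⊥) (i : Fin n) :
    ∃ x ∈ N, x ≠ 0 ∧ adLie K n (gen K n (Sum.inl i)) x = 0 := by
  obtain ⟨x, hx, hx0⟩ := N.ne_bot_iff.1 h0
  obtain ⟨d, hd⟩ := exists_mem_filtration x
  set p := gen K n (Sum.inl i) with hp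
  have hcomm : Commute (LinearMap.mulLeft K p + LinearMap.mulRight K p) (adLie K n p) := by
    refine LinearMap.ext fun y => ?_
    simp only [Module.End.mul_apply, LinearMap.add_apply, LinearMap.mulLeft_apply,
      LinearMap.mulRight_apply, adLie_apply]
    noncomm_ring
  have hT : adLie K n (p * p) =
      (LinearMap.mulLeft K p + LinearMap.mulRight K p) * adLie K n p :=
    LinearMap.ext fun y => adLie_mul_left p p y
  obtain ⟨y, hy, hy0, hTy⟩ := exists_mem_ker_of_pow_apply_eq_zero
    (hN (p * p) (gen_mul_gen_mem_part_zero _ _)) (d + 1) x hx hx0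
    (by rw [hT, hcomm.mul_pow, Module.End.mul_apply, adLie_gen_pow_eq_zero _ hd, map_zero])
  refine ⟨y, hy, hy0, eq_zero_of_gen_mul_add_mul_gen_eq_zero (Sum.inl i) ?_⟩
  rwa [adLie_mul_left] at hTy

theorem symplecticForm_inl_of_ne {i : Fin n} {b : Fin n ⊕ Fin n} (hb : b ≠ Sum.inr i) :
    symplecticForm K n b (Sum.inl i) = 0 := by
  rcases b with j | j
  · rfl
  · have : j ≠ i := fun h => hb (by rw [h])
    simp [symplecticForm, this]

/-- On the kernel of `[p_i, ·]`, commutation with the even element `p_i a` is the locally nilpotent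
operator `p_i [a, ·]`. -/
theorem exists_mem_forall_adLie_eq_zero [CharZero K] {N : Submodule K (WeylAlgebra K n)}
    (hN : ∀ F ∈ part K n 0, ∀ x ∈ N, adLie K n F x ∈ N) (h0 : N ≠ ⊥) (i : Fin n)
    (s : Finset (Fin n ⊕ Fin n)) (hs : Sum.inr i ∉ s) :
    ∃ x ∈ N, x ≠ 0 ∧ adLie K n (gen K n (Sum.inl i)) x = 0 ∧
      ∀ b ∈ s, adLie K n (gen K n b) x = 0 := by
  induction s using Finset.induction_on with
  | empty =>
    obtain ⟨x, hx, hx0, h⟩ := exists_mem_adLie_inl_eq_zero hN h0 i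
    exact ⟨x, hx, hx0, h, by simp⟩
  | insert a s _ ih =>
    rw [Finset.mem_insert, not_or] at hs
    obtain ⟨x, hx, hx0, hpx, hsx⟩ := ih hs.2
    obtain ⟨d, hd⟩ := exists_mem_filtration x
    have hmem : ∀ y, y ∈ N ⊓ LinearMap.ker (adLie K n (gen K n (Sum.inl i))) ⊓
        ⨅ b ∈ s, LinearMap.ker (adLie K n (gen K n b)) ↔
        (y ∈ N ∧ adLie K n (gen K n (Sum.inl i)) y = 0) ∧
          ∀ b ∈ s, adLie K n (gen K n b) y = 0 := fun y => by
      simp [Submodule.mem_iInf]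
    have hpp : symplecticForm K n (Sum.inl i) (Sum.inl i) = 0 := rfl
    have hcomm : Commute (LinearMap.mulLeft K (gen K n (Sum.inl i))) (adLie K n (gen K n a)) :=
      LinearMap.ext fun y => by
        simp [adLie_mul, adLie_gen_gen, symplecticForm_inl_of_ne (Ne.symm hs.1)]
    have hstable : ∀ y ∈ N ⊓ LinearMap.ker (adLie K n (gen K n (Sum.inl i))) ⊓
        ⨅ b ∈ s, LinearMap.ker (adLie K n (gen K n b)),
        (LinearMap.mulLeft K (gen K n (Sum.inl i)) * adLie K n (gen K n a)) y ∈
          N ⊓ LinearMap.ker (adLie K n (gen K n (Sum.inl i))) ⊓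
            ⨅ b ∈ s, LinearMap.ker (adLie K n (gen K n b)) := by
      intro y hy
      obtain ⟨⟨hyN, hpy⟩, hsy⟩ := (hmem y).1 hy
      rw [Module.End.mul_apply, LinearMap.mulLeft_apply]
      refine (hmem _).2 ⟨⟨?_, ?_⟩, fun b hb => ?_⟩
      · have h := hN _ (gen_mul_gen_mem_part_zero (Sum.inl i) a) y hyN
        rwa [adLie_mul_left, hpy, zero_mul, add_zero] at h
      · rw [adLie_mul, adLie_gen_gen, hpp, map_zero, zero_mul, zero_add, adLie_gen_comm, hpy,
          map_zero, mul_zero]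
      · have hbi : b ≠ Sum.inr i := fun h => hs.2 (h ▸ hb)
        rw [adLie_mul, adLie_gen_gen, symplecticForm_inl_of_ne hbi, map_zero, zero_mul, zero_add,
          adLie_gen_comm, hsy b hb, map_zero, mul_zero]
    obtain ⟨y, hy, hy0, hTy⟩ := exists_mem_ker_of_pow_apply_eq_zero hstable (d + 1) x
      ((hmem x).2 ⟨⟨hx, hpx⟩, hsx⟩) hx0
      (by rw [hcomm.mul_pow, Module.End.mul_apply, adLie_gen_pow_eq_zero _ hd, map_zero])
    obtain ⟨⟨hyN, hpy⟩, hsy⟩ := (hmem y).1 hy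
    refine ⟨y, hyN, hy0, hpy, fun b hb => ?_⟩
    rcases Finset.mem_insert.1 hb with rfl | hb
    · rw [Module.End.mul_apply, LinearMap.mulLeft_apply] at hTy
      have hc : adLie K n (gen K n (Sum.inl i)) (adLie K n (gen K n b) y) = 0 := by
        rw [adLie_gen_comm, hpy, map_zero]
      rw [adLie_apply, hTy, zero_sub, neg_eq_zero] at hc
      exact eq_zero_of_gen_mul_add_mul_gen_eq_zero (Sum.inl i) (by rw [hTy, hc, add_zero])
    · exact hsy b hb

open Polynomial in
theorem adLie_inr_aeval (i : Fin n) (f : K[X]) :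
    adLie K n (gen K n (Sum.inr i)) (aeval (gen K n (Sum.inl i)) f) =
      -aeval (gen K n (Sum.inl i)) (derivative f) := by
  have hqp : adLie K n (gen K n (Sum.inr i)) (gen K n (Sum.inl i)) = -1 := by
    simp [adLie_gen_gen, symplecticForm]
  induction f using Polynomial.induction_on' with
  | add f g hf hg => rw [map_add, map_add, hf, hg, map_add, map_add, neg_add]
  | monomial k c =>
    rw [← C_mul_X_pow_eq_monomial, map_mul, aeval_C, adLie_mul, adLie_algebraMap, zero_mul,
      zero_add, derivative_C_mul, map_mul, aeval_C, ← mul_neg]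
    congr 1
    rw [map_pow, aeval_X]
    induction k with
    | zero => simpa using adLie_algebraMap (gen K n (Sum.inr i)) 1
    | succ k ih =>
      rw [pow_succ, adLie_mul, ih, hqp, pow_succ X, derivative_mul, derivative_X]
      simp only [map_add, map_mul, map_pow, aeval_X, mul_one, mul_neg, neg_mul]
      abel

open Polynomial in
theorem exists_derivative_eq [CharZero K] (f : K[X]) : ∃ g : K[X], derivative g = f := by
  induction f using Polynomial.induction_on' with
  | add f g hf hg =>
    obtain ⟨f', rfl⟩ := hf
    obtain ⟨g', rfl⟩ := hg
    exact ⟨f' + g', derivative_add⟩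
  | monomial k c =>
    refine ⟨monomial (k + 1) (c * ((k + 1 : ℕ) : K)⁻¹), ?_⟩
    rw [derivative_monomial, inv_mul_cancel_right₀ (Nat.cast_ne_zero.2 (Nat.succ_ne_zero k)),
      Nat.add_sub_cancel]

open Polynomial in
theorem exists_eq_aeval_of_adLie_eq_zero [CharZero K] (i : Fin n) {x : WeylAlgebra K n}
    (hx : ∀ b ≠ Sum.inr i, adLie K n (gen K n b) x = 0) :
    ∃ f : K[X], x = aeval (gen K n (Sum.inl i)) f := by
  obtain ⟨d, hd⟩ := exists_mem_filtration x
  induction d generalizing x with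
  | zero =>
    rw [filtration_zero] at hd
    obtain ⟨c, rfl⟩ := hd
    exact ⟨C c, by simp⟩
  | succ d ih =>
    obtain ⟨f, hf⟩ := ih (x := adLie K n (gen K n (Sum.inr i)) x)
      (fun b hb => by rw [adLie_gen_comm, hx b hb, map_zero]) (adLie_gen_mem_filtration _ hd)
    obtain ⟨g, rfl⟩ := exists_derivative_eq f
    obtain ⟨c, hc⟩ : x + aeval (gen K n (Sum.inl i)) g ∈ scalars K n := by
      refine mem_scalars_of_adLie_gen_eq_zero fun b => ?_
      rw [map_add]
      by_cases hb : b = Sum.inr i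
      · rw [hb, hf, adLie_inr_aeval, add_neg_cancel]
      · have hcomm : Commute (gen K n b) (gen K n (Sum.inl i)) := by
          refine sub_eq_zero.1 ?_
          rw [← adLie_apply, adLie_gen_gen, symplecticForm_inl_of_ne hb, map_zero]
        rw [hx b hb, zero_add, adLie_apply, sub_eq_zero]
        exact Polynomial.induction_on' (motive := fun g => Commute (gen K n b)
            (aeval (gen K n (Sum.inl i)) g)) g
          (fun f g hf hg => by rw [map_add]; exact hf.add_right hg)
          (fun k c => by
            rw [aeval_monomial]
            exact Commute.mul_right (Algebra.commutes c _).symm (hcomm.pow_right k))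
    exact ⟨C c - g, by rw [map_sub, aeval_C, ← Algebra.linearMap_apply, hc, add_sub_cancel_right]⟩

open Polynomial in
/-- A nonzero subspace of polynomials stable under `X d/dX` contains a monomial. -/
theorem exists_X_pow_mem [CharZero K] {S : Submodule K K[X]}
    (hS : ∀ f ∈ S, X * derivative f ∈ S) {f : K[X]} (hf : f ∈ S) (hf0 : f ≠ 0) :
    ∃ k : ℕ, (X : K[X]) ^ k ∈ S := by
  induction hm : f.support.card using Nat.strong_induction_on generalizing f with
  | _ m ih =>
    obtain ⟨k, hk⟩ := Polynomial.support_nonempty.2 hf0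
    have hcoeff : ∀ j : ℕ, (X * derivative f - (k : K) • f).coeff j = ((j : K) - k) * f.coeff j := by
      intro j
      rw [coeff_sub, coeff_smul, smul_eq_mul, sub_mul]
      congr 1
      cases j with
      | zero => simp
      | succ j => rw [coeff_X_mul, coeff_derivative]; push_cast; ring
    by_cases h0 : X * derivative f - (k : K) • f = 0
    · refine ⟨k, (S.smul_mem_iff (Polynomial.mem_support_iff.1 hk)).1 ?_⟩
      convert hf using 1
      ext j
      have hj := hcoeff j
      rw [h0, coeff_zero, zero_eq_mul, sub_eq_zero, Nat.cast_inj] at hj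
      rw [coeff_smul, coeff_X_pow, smul_eq_mul]
      split_ifs with hjk
      · rw [mul_one, hjk]
      · rw [mul_zero, hj.resolve_left hjk]
    · refine ih _ ?_ (sub_mem (hS f hf) (S.smul_mem _ hf)) h0 rfl
      rw [← hm]
      refine Finset.card_lt_card ((Finset.ssubset_iff_of_subset fun j hj => ?_).2 ⟨k, hk, ?_⟩)
      · rw [Polynomial.mem_support_iff, hcoeff] at hj
        exact Polynomial.mem_support_iff.2 (right_ne_zero_of_mul hj)
      · rw [Polynomial.mem_support_iff, hcoeff, sub_self, zero_mul]
        exact not_not.2 rfl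

theorem exists_pow_mem [CharZero K] {N : Submodule K (WeylAlgebra K n)}
    (hN : ∀ F ∈ part K n 0, ∀ x ∈ N, adLie K n F x ∈ N) (h0 : N ≠ ⊥) (i : Fin n) :
    ∃ k : ℕ, gen K n (Sum.inl i) ^ k ∈ N := by
  obtain ⟨x, hx, hx0, -, h⟩ := exists_mem_forall_adLie_eq_zero hN h0 i
    (Finset.univ.erase (Sum.inr i)) (Finset.notMem_erase _ _)
  obtain ⟨f, rfl⟩ := exists_eq_aeval_of_adLie_eq_zero i
    fun b hb => h b (Finset.mem_erase.2 ⟨hb, Finset.mem_univ _⟩)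
  have hstable : ∀ g ∈ N.comap (Polynomial.aeval (gen K n (Sum.inl i))).toLinearMap,
      Polynomial.X * Polynomial.derivative g ∈
        N.comap (Polynomial.aeval (gen K n (Sum.inl i))).toLinearMap := by
    intro g hg
    -- `[p q, ·]` acts on polynomials in `p` as `-X d/dX`
    have h1 := hN _ (gen_mul_gen_mem_part_zero (Sum.inl i) (Sum.inr i)) _ hg
    have h2 : adLie K n (gen K n (Sum.inl i))
        (Polynomial.aeval (gen K n (Sum.inl i)) g) = 0 := by
      rw [adLie_apply, sub_eq_zero]
      conv_lhs => enter [1]; rw [← Polynomial.aeval_X (R := K) (gen K n (Sum.inl i))]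
      conv_rhs => enter [2]; rw [← Polynomial.aeval_X (R := K) (gen K n (Sum.inl i))]
      rw [← map_mul, ← map_mul, mul_comm]
    rw [AlgHom.toLinearMap_apply, adLie_mul_left, h2, zero_mul, add_zero, adLie_inr_aeval, mul_neg,
      neg_mem_iff] at h1
    simpa using h1
  obtain ⟨k, hk⟩ := exists_X_pow_mem hstable hx (by rintro rfl; exact hx0 (map_zero _))
  exact ⟨k, by simpa using hk⟩

theorem adLie_sq (q x : WeylAlgebra K n) : adLie K n (q * q) x =
    (2 : K) • (q * adLie K n q x) - adLie K n q (adLie K n q x) := by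
  rw [two_smul]
  simp only [adLie_apply]
  noncomm_ring

theorem adLie_cube (q x : WeylAlgebra K n) : adLie K n (q * q * q) x =
    (3 : K) • (q * q * adLie K n q x) - (3 : K) • (q * adLie K n q (adLie K n q x)) +
      adLie K n q (adLie K n q (adLie K n q x)) := by
  have h3 : ∀ y : WeylAlgebra K n, (3 : K) • y = y + y + y := fun y => by module
  rw [h3, h3]
  simp only [adLie_apply]
  noncomm_ring

/-- Write `k = m + 3`, so that `p ^ (k - 2)` is obtained from `p ^ k`. The elements
`[q ^ 2, [q ^ 2, [q p ^ 3, p ^ k]]]`, `[q ^ 3 p, p ^ k]` and `[q ^ 2, p ^ k]` are combinations of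
`q ^ 2 p ^ k`, `q p ^ (k - 1)` and `p ^ (k - 2)`, and the last of these is a combination of
the three elements. -/
theorem pow_add_one_mem [CharZero K] {N : Submodule K (WeylAlgebra K n)}
    (hN : ∀ F ∈ part K n 0, ∀ x ∈ N, adLie K n F x ∈ N) (i : Fin n) {m : ℕ}
    (h : gen K n (Sum.inl i) ^ (m + 3) ∈ N) : gen K n (Sum.inl i) ^ (m + 1) ∈ N := by
  set p := gen K n (Sum.inl i) with hp
  set q := gen K n (Sum.inr i) with hq
  have hD : ∀ j : ℕ, adLie K n q (p ^ (j + 1)) = (-((j : K) + 1)) • p ^ j := fun j => by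
    have h := adLie_inr_aeval (K := K) i (Polynomial.X ^ (j + 1))
    simp only [map_pow, Polynomial.aeval_X, Polynomial.derivative_X_pow, map_mul,
      Nat.add_sub_cancel] at h
    rw [h, neg_smul, Algebra.smul_def, Polynomial.aeval_C]
    push_cast
    rfl
  have hqq : q * q ∈ part K n 0 := gen_mul_gen_mem_part_zero _ _
  have hk : ∀ j : ℕ, (m : K) + j + 1 ≠ 0 := fun j => by exact_mod_cast Nat.succ_ne_zero (m + j)
  have hk0 : (m : K) + 1 ≠ 0 := by simpa using hk 0
  have hk1 : (m : K) + 2 ≠ 0 := by simpa [add_assoc, one_add_one_eq_two] using hk 1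
  have hk2 : (m : K) + 3 ≠ 0 := by
    have := hk 2
    norm_num [add_assoc] at this
    exact this
  have hk3 : (m : K) + 4 ≠ 0 := by
    have := hk 3
    norm_num [add_assoc] at this
    exact this
  have hk4 : (m : K) + 5 ≠ 0 := by
    have := hk 4
    norm_num [add_assoc] at this
    exact this
  have h5 : p ^ (m + 5) ∈ N := by
    have h1 := hN (q * (p * p * p)) (by simp [mem_part_zero, hp, hq, parity_gen]) _ h
    have h2 : adLie K n (p * p * p) (p ^ (m + 3)) = 0 := by
      rw [adLie_apply, ← pow_three', ← pow_add, ← pow_add, add_comm, sub_self]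
    rw [adLie_mul_left, h2, mul_zero, zero_add, hD, smul_mul_assoc, ← pow_three', ← pow_add] at h1
    refine (N.smul_mem_iff (neg_ne_zero.2 ?_)).1 h1
    push_cast
    rw [add_assoc]
    norm_num
    exact hk2
  have hu : (4 : K) • (q * q * p ^ (m + 3)) + (4 * (m + 3) : K) • (q * p ^ (m + 2)) +
      ((m + 3) * (m + 2) : K) • p ^ (m + 1) ∈ N := by
    have h1 := hN _ hqq _ (hN _ hqq _ h5)
    refine (N.smul_mem_iff (mul_ne_zero hk4 hk3)).1 ?_
    convert h1 using 1
    have hqD : ∀ y, adLie K n q (q * y) = q * adLie K n q y := fun y => by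
      rw [adLie_mul, adLie_apply q q, sub_self, zero_mul, zero_add]
    simp only [adLie_sq, hD, map_sub, map_smul, hqD, mul_smul_comm, ← mul_assoc]
    push_cast
    module
  have hv : (3 : K) • (q * q * p ^ (m + 3)) + (3 * (m + 2) : K) • (q * p ^ (m + 2)) +
      ((m + 2) * (m + 1) : K) • p ^ (m + 1) ∈ N := by
    have h1 := hN (q * q * q * p) (by simp [mem_part_zero, hp, hq, parity_gen]) _ h
    have h2 : adLie K n p (p ^ (m + 3)) = 0 := by
      rw [adLie_apply, ← pow_succ', ← pow_succ, sub_self]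
    refine (N.smul_mem_iff (neg_ne_zero.2 hk2)).1 ?_
    convert h1 using 1
    rw [adLie_mul_left, h2, mul_zero, zero_add, adLie_cube]
    simp only [hD, map_smul, mul_smul_comm, add_mul, sub_mul, smul_mul_assoc, mul_assoc,
      ← pow_succ]
    push_cast
    module
  have hw : (2 : K) • (q * p ^ (m + 2)) + (m + 2 : K) • p ^ (m + 1) ∈ N := by
    refine (N.smul_mem_iff (neg_ne_zero.2 hk2)).1 ?_
    convert hN _ hqq _ h using 1
    simp only [adLie_sq, hD, map_smul, mul_smul_comm]
    push_cast
    module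
  refine (N.smul_mem_iff (mul_ne_zero hk1 hk0)).1 ?_
  convert add_mem (sub_mem (N.smul_mem 4 hv) (N.smul_mem 3 hu)) (N.smul_mem 6 hw) using 1
  module

theorem exists_pow_mem_le_two [CharZero K] {N : Submodule K (WeylAlgebra K n)}
    (hN : ∀ F ∈ part K n 0, ∀ x ∈ N, adLie K n F x ∈ N) (h0 : N ≠ ⊥) (i : Fin n) :
    1 ∈ N ∨ gen K n (Sum.inl i) ∈ N ∨ gen K n (Sum.inl i) ^ 2 ∈ N := by
  obtain ⟨k, hk⟩ := exists_pow_mem hN h0 i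
  induction k using Nat.strong_induction_on with
  | _ k ih =>
    match k, hk, ih with
    | 0, hk, _ => exact Or.inl (by simpa using hk)
    | 1, hk, _ => exact Or.inr (Or.inl (by simpa using hk))
    | 2, hk, _ => exact Or.inr (Or.inr hk)
    | m + 3, hk, ih => exact ih (m + 1) (by omega) (pow_add_one_mem hN i hk)

/-! ### The four actions -/

theorem adLieTwisted_apply [CharZero K] (F G : WeylAlgebra K n) :
    adLieTwisted K n F G = F * G - G * parity K n F := by
  obtain ⟨F0, hF0, F1, hF1, rfl⟩ := exists_add_mem_part F
  obtain ⟨G0, hG0, G1, hG1, rfl⟩ := exists_add_mem_part G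
  simp only [adLieTwisted, map_add, LinearMap.add_apply, signedCommutator_of_mem _ hF0 hG0,
    signedCommutator_of_mem _ hF0 hG1, signedCommutator_of_mem _ hF1 hG0,
    signedCommutator_of_mem _ hF1 hG1, mem_part_zero.1 hF0, mem_part_one.1 hF1]
  norm_num
  noncomm_ring

theorem adSuper_of_mem_part_zero [CharZero K] {F : WeylAlgebra K n} (hF : F ∈ part K n 0)
    (G : WeylAlgebra K n) : adSuper K n F G = F * G - G * F := by
  obtain ⟨G0, hG0, G1, hG1, rfl⟩ := exists_add_mem_part G
  simp only [adSuper, map_add, signedCommutator_of_mem _ hF hG0, signedCommutator_of_mem _ hF hG1]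
  norm_num
  noncomm_ring

theorem adSuper_of_mem_part_one [CharZero K] {F : WeylAlgebra K n} (hF : F ∈ part K n 1)
    (G : WeylAlgebra K n) : adSuper K n F G = F * G - parity K n G * F := by
  obtain ⟨G0, hG0, G1, hG1, rfl⟩ := exists_add_mem_part G
  simp only [adSuper, map_add, signedCommutator_of_mem _ hF hG0, signedCommutator_of_mem _ hF hG1,
    mem_part_zero.1 hG0, mem_part_one.1 hG1]
  norm_num
  noncomm_ring

theorem adSuperTwisted_of_mem_part_zero [CharZero K] {F : WeylAlgebra K n} (hF : F ∈ part K n 0)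
    (G : WeylAlgebra K n) : adSuperTwisted K n F G = F * G - G * F := by
  obtain ⟨G0, hG0, G1, hG1, rfl⟩ := exists_add_mem_part G
  simp only [adSuperTwisted, map_add, signedCommutator_of_mem _ hF hG0,
    signedCommutator_of_mem _ hF hG1]
  norm_num
  noncomm_ring

theorem adSuperTwisted_of_mem_part_one [CharZero K] {F : WeylAlgebra K n} (hF : F ∈ part K n 1)
    (G : WeylAlgebra K n) : adSuperTwisted K n F G = F * G + parity K n G * F := by
  obtain ⟨G0, hG0, G1, hG1, rfl⟩ := exists_add_mem_part G
  simp only [adSuperTwisted, map_add, signedCommutator_of_mem _ hF hG0,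
    signedCommutator_of_mem _ hF hG1, mem_part_zero.1 hG0, mem_part_one.1 hG1]
  norm_num
  noncomm_ring

theorem isLieRep_adLie : IsLieRep (adLie K n) := by
  intro x y
  refine LinearMap.ext fun z => ?_
  rw [LieRing.of_associative_ring_bracket]
  simp only [LinearMap.sub_apply, Module.End.mul_apply, adLie_apply]
  noncomm_ring

theorem isLieRep_adLieTwisted [CharZero K] : IsLieRep (adLieTwisted K n) := by
  intro x y
  refine LinearMap.ext fun z => ?_
  rw [LieRing.of_associative_ring_bracket]
  simp only [LinearMap.sub_apply, Module.End.mul_apply, adLieTwisted_apply, map_sub, map_mul]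
  noncomm_ring

/-- The degrees `a, b : ℕ` in `IsSuperRep` matter only modulo `2`. -/
theorem isSuperRep_of_parts {ρ : WeylAlgebra K n →ₗ[K] Module.End K (WeylAlgebra K n)}
    (h00 : ∀ F ∈ part K n 0, ∀ G ∈ part K n 0, ρ F G ∈ part K n 0 ∧
      ρ (adSuper K n F G) = ρ F * ρ G - ρ G * ρ F)
    (h01 : ∀ F ∈ part K n 0, ∀ G ∈ part K n 1, ρ F G ∈ part K n 1 ∧
      ρ (adSuper K n F G) = ρ F * ρ G - ρ G * ρ F)
    (h10 : ∀ F ∈ part K n 1, ∀ G ∈ part K n 0, ρ F G ∈ part K n 1 ∧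
      ρ (adSuper K n F G) = ρ F * ρ G - ρ G * ρ F)
    (h11 : ∀ F ∈ part K n 1, ∀ G ∈ part K n 1, ρ F G ∈ part K n 0 ∧
      ρ (adSuper K n F G) = ρ F * ρ G + ρ G * ρ F) : IsSuperRep ρ := by
  have key : ∀ a b : ℕ, ∀ F ∈ part K n a, ∀ G ∈ part K n b, ρ F G ∈ part K n (a + b) ∧
      ρ (adSuper K n F G) = ρ F * ρ G - (-1 : K) ^ (a * b) • (ρ G * ρ F) := by
    intro a b F hF G hG
    have hadd : part K n (a + b) = Module.End.eigenspace (parity K n).toLinearMap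
      ((-1) ^ a * (-1) ^ b) := by rw [part, pow_add]
    have h0 : part K n 0 = Module.End.eigenspace (parity K n).toLinearMap 1 := by simp [part]
    have h1 : part K n 1 = Module.End.eigenspace (parity K n).toLinearMap (-1) := by simp [part]
    rw [hadd, pow_mul]
    rcases part_eq (K := K) (n := n) a with ⟨ha, ha'⟩ | ⟨ha, ha'⟩ <;>
      rcases part_eq (K := K) (n := n) b with ⟨hb, hb'⟩ | ⟨hb, hb'⟩ <;>
      rw [ha] at hF <;> rw [hb] at hG <;> rw [ha', hb']
    · simpa [h0] using h00 F hF G hG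
    · simpa [h1] using h01 F hF G hG
    · simpa [h1] using h10 F hF G hG
    · simpa [h0] using h11 F hF G hG
  exact ⟨fun a b F hF G hG => (key a b F hF G hG).1, fun a b F hF G hG => (key a b F hF G hG).2⟩

theorem mul_sub_mul_mem_part {F G : WeylAlgebra K n} :
    (F ∈ part K n 0 → G ∈ part K n 0 → F * G - G * F ∈ part K n 0) ∧
    (F ∈ part K n 0 → G ∈ part K n 1 → F * G - G * F ∈ part K n 1) ∧
    (F ∈ part K n 1 → G ∈ part K n 0 → F * G - G * F ∈ part K n 1) ∧
    (F ∈ part K n 1 → G ∈ part K n 1 → F * G - G * F ∈ part K n 0) := by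
  simp only [mem_part_zero, mem_part_one, map_sub, map_mul]
  refine ⟨?_, ?_, ?_, ?_⟩ <;> intro hF hG <;> rw [hF, hG] <;> noncomm_ring

theorem mul_add_mul_mem_part {F G : WeylAlgebra K n} :
    (F ∈ part K n 1 → G ∈ part K n 0 → F * G + G * F ∈ part K n 1) ∧
    (F ∈ part K n 1 → G ∈ part K n 1 → F * G + G * F ∈ part K n 0) := by
  simp only [mem_part_zero, mem_part_one, map_add, map_mul]
  refine ⟨?_, ?_⟩ <;> intro hF hG <;> rw [hF, hG] <;> noncomm_ring

theorem isSuperRep_adSuper [CharZero K] : IsSuperRep (adSuper K n) := by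
  refine isSuperRep_of_parts ?_ ?_ ?_ ?_ <;> intro F hF G hG
  · rw [adSuper_of_mem_part_zero hF]
    have h := mul_sub_mul_mem_part.1 hF hG
    refine ⟨h, LinearMap.ext fun x => ?_⟩
    rw [adSuper_of_mem_part_zero h]
    simp only [LinearMap.sub_apply, Module.End.mul_apply,
      adSuper_of_mem_part_zero hF, adSuper_of_mem_part_zero hG]
    noncomm_ring
  · rw [adSuper_of_mem_part_zero hF]
    have h := mul_sub_mul_mem_part.2.1 hF hG
    refine ⟨h, LinearMap.ext fun x => ?_⟩
    rw [adSuper_of_mem_part_one h]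
    simp only [LinearMap.sub_apply, Module.End.mul_apply,
      adSuper_of_mem_part_zero hF, adSuper_of_mem_part_one hG, map_sub, map_mul,
      mem_part_zero.1 hF]
    noncomm_ring
  · rw [adSuper_of_mem_part_one hF, mem_part_zero.1 hG]
    have h := mul_sub_mul_mem_part.2.2.1 hF hG
    refine ⟨h, LinearMap.ext fun x => ?_⟩
    rw [adSuper_of_mem_part_one h]
    simp only [LinearMap.sub_apply, Module.End.mul_apply,
      adSuper_of_mem_part_one hF, adSuper_of_mem_part_zero hG, map_sub, map_mul,
      mem_part_zero.1 hG]
    noncomm_ring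
  · rw [adSuper_of_mem_part_one hF, mem_part_one.1 hG, neg_mul, sub_neg_eq_add]
    have h := mul_add_mul_mem_part.2 hF hG
    refine ⟨h, LinearMap.ext fun x => ?_⟩
    rw [adSuper_of_mem_part_zero h]
    simp only [LinearMap.add_apply, Module.End.mul_apply,
      adSuper_of_mem_part_one hF, adSuper_of_mem_part_one hG, map_sub, map_mul,
      mem_part_one.1 hF, mem_part_one.1 hG, parity_parity]
    noncomm_ring

theorem isSuperRep_adSuperTwisted [CharZero K] : IsSuperRep (adSuperTwisted K n) := by
  refine isSuperRep_of_parts ?_ ?_ ?_ ?_ <;> intro F hF G hG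
  · rw [adSuper_of_mem_part_zero hF, adSuperTwisted_of_mem_part_zero hF]
    have h := mul_sub_mul_mem_part.1 hF hG
    refine ⟨h, LinearMap.ext fun x => ?_⟩
    rw [adSuperTwisted_of_mem_part_zero h]
    simp only [LinearMap.sub_apply, Module.End.mul_apply,
      adSuperTwisted_of_mem_part_zero hF, adSuperTwisted_of_mem_part_zero hG]
    noncomm_ring
  · rw [adSuper_of_mem_part_zero hF, adSuperTwisted_of_mem_part_zero hF]
    have h := mul_sub_mul_mem_part.2.1 hF hG
    refine ⟨h, LinearMap.ext fun x => ?_⟩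
    rw [adSuperTwisted_of_mem_part_one h]
    simp only [LinearMap.sub_apply, Module.End.mul_apply,
      adSuperTwisted_of_mem_part_zero hF, adSuperTwisted_of_mem_part_one hG, map_sub, map_mul,
      mem_part_zero.1 hF]
    noncomm_ring
  · rw [adSuper_of_mem_part_one hF, adSuperTwisted_of_mem_part_one hF, mem_part_zero.1 hG]
    have h := mul_sub_mul_mem_part.2.2.1 hF hG
    refine ⟨mul_add_mul_mem_part.1 hF hG, LinearMap.ext fun x => ?_⟩
    rw [adSuperTwisted_of_mem_part_one h]
    simp only [LinearMap.sub_apply, Module.End.mul_apply,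
      adSuperTwisted_of_mem_part_one hF, adSuperTwisted_of_mem_part_zero hG, map_sub, map_mul,
      mem_part_zero.1 hG]
    noncomm_ring
  · rw [adSuper_of_mem_part_one hF, adSuperTwisted_of_mem_part_one hF, mem_part_one.1 hG, neg_mul,
      sub_neg_eq_add, ← sub_eq_add_neg]
    have h := mul_add_mul_mem_part.2 hF hG
    refine ⟨mul_sub_mul_mem_part.2.2.2 hF hG, LinearMap.ext fun x => ?_⟩
    rw [adSuperTwisted_of_mem_part_zero h]
    simp only [LinearMap.add_apply, Module.End.mul_apply,
      adSuperTwisted_of_mem_part_one hF, adSuperTwisted_of_mem_part_one hG, map_add, map_mul,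
      mem_part_one.1 hF, mem_part_one.1 hG, parity_parity]
    noncomm_ring

/-! ### The adjoint representation of the Lie algebra -/

theorem isSubrep_scalars_adLie : IsSubrep (adLie K n) (scalars K n) := fun F x hx => by
  rw [adLie_eq_zero_of_mem_scalars F hx]
  exact zero_mem _

theorem scalars_eq_span : scalars K n = K ∙ (1 : WeylAlgebra K n) := by
  rw [scalars, ← Submodule.one_eq_range, Submodule.one_eq_span]

theorem bot_lt_scalars [CharZero K] : (⊥ : Submodule K (WeylAlgebra K n)) < scalars K n := by
  rw [bot_lt_iff_ne_bot, scalars_eq_span, Ne, Submodule.span_singleton_eq_bot]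
  exact one_ne_zero

theorem eq_bot_or_eq_of_le_scalars {N : Submodule K (WeylAlgebra K n)} (h : N ≤ scalars K n) :
    N = ⊥ ∨ N = scalars K n := by
  by_cases h0 : N = ⊥
  · exact Or.inl h0
  · obtain ⟨x, hx, hx0⟩ := N.ne_bot_iff.1 h0
    obtain ⟨c, rfl⟩ := h hx
    have hc : c ≠ 0 := by rintro rfl; exact hx0 (map_zero _)
    refine Or.inr (le_antisymm h ?_)
    rw [scalars_eq_span, Submodule.span_singleton_le_iff_mem]
    rwa [Algebra.linearMap_apply, Algebra.algebraMap_eq_smul_one, N.smul_mem_iff hc] at hx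

/-- A Lie ideal with a non-scalar element contains one whose brackets with all generators are
scalars, since these brackets lower the filtration. As the centre is `K`, one of them is nonzero, and
then the ideal contains a generator. -/
theorem eq_top_of_not_le_scalars [CharZero K] {N : Submodule K (WeylAlgebra K n)}
    (hN : IsSubrep (adLie K n) N) (h : ¬ N ≤ scalars K n) : N = ⊤ := by
  obtain ⟨x, hx, hxs⟩ := SetLike.not_le_iff_exists.1 h
  obtain ⟨d, hd⟩ := exists_mem_filtration x
  suffices hgen : ∃ a, gen K n a ∈ N by
    obtain ⟨a, ha⟩ := hgen
    refine eq_top_iff.2 fun z _ => ?_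
    obtain ⟨y, rfl⟩ := exists_adLie_gen_eq a z
    rw [adLie_apply, ← neg_sub, ← adLie_apply, neg_mem_iff]
    exact hN y _ ha
  induction d generalizing x with
  | zero =>
    rw [filtration_zero] at hd
    exact absurd hd hxs
  | succ d ih =>
    by_cases hall : ∀ a, adLie K n (gen K n a) x ∈ scalars K n
    · obtain ⟨a, ha⟩ : ∃ a, adLie K n (gen K n a) x ≠ 0 := by
        by_contra! h0
        exact hxs (mem_scalars_of_adLie_gen_eq_zero h0)
      obtain ⟨c, hc⟩ := hall a
      have hc0 : c ≠ 0 := by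
        rintro rfl
        exact ha (by rw [← hc, map_zero])
      -- `[a ^ 2, x] = 2 c a`
      have h1 := hN (gen K n a * gen K n a) x hx
      rw [adLie_sq, ← hc, Algebra.linearMap_apply, adLie_algebraMap, sub_zero, ← Algebra.commutes,
        ← Algebra.smul_def, smul_smul] at h1
      exact ⟨a, (N.smul_mem_iff (mul_ne_zero two_ne_zero hc0)).1 h1⟩
    · push Not at hall
      obtain ⟨a, ha⟩ := hall
      exact ih _ (hN _ x hx) ha (adLie_gen_mem_filtration a hd)

theorem scalars_lt_top [CharZero K] (i : Fin n) : scalars K n < ⊤ :=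
  lt_top_iff_ne_top.2 fun h =>
    gen_notMem_scalars (K := K) (Sum.inl i) (by rw [h]; exact Submodule.mem_top)

theorem isIndecomposableRep_adLie [CharZero K] : IsIndecomposableRep (adLie K n) := by
  refine ⟨inferInstance, fun U V hU hV hUV => ?_⟩
  have hone : ∀ N, IsSubrep (adLie K n) N → N ≠ ⊥ → (1 : WeylAlgebra K n) ∈ N := by
    intro N hN h0
    by_cases h : N ≤ scalars K n
    · rw [(eq_bot_or_eq_of_le_scalars h).resolve_left h0]
      exact ⟨1, map_one (algebraMap K _)⟩
    · rw [eq_top_of_not_le_scalars hN h]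
      exact Submodule.mem_top
  by_contra! h
  exact one_ne_zero (Submodule.disjoint_def.1 hUV.disjoint 1 (hone U hU h.1) (hone V hV h.2))

/-! ### The twisted and the super representations -/

theorem gen_inr_mul_sub_gen_inl_sq_mul (i : Fin n) :
    gen K n (Sum.inr i) * gen K n (Sum.inl i) ^ 2 -
      gen K n (Sum.inl i) ^ 2 * gen K n (Sum.inr i) = (-2 : K) • gen K n (Sum.inl i) := by
  have h := adLie_inr_aeval (K := K) i (Polynomial.X ^ 2)
  simp only [map_pow, Polynomial.aeval_X, adLie_apply] at h
  rw [h, Polynomial.derivative_X_sq, map_mul, Polynomial.aeval_C, Polynomial.aeval_X,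
    ← Algebra.smul_def, neg_smul]

/-- The anticommutators of `p_i` with `1` and with `p_i ^ 2` are `2 p_i` and `2 p_i ^ 3`, and the
exponent `3` can be lowered to `1`. -/
theorem gen_inl_mem [CharZero K] {N : Submodule K (WeylAlgebra K n)}
    (hN : ∀ F ∈ part K n 0, ∀ x ∈ N, adLie K n F x ∈ N) (h0 : N ≠ ⊥) (i : Fin n)
    (hp : ∀ x ∈ N, x ∈ part K n 0 →
      gen K n (Sum.inl i) * x + x * gen K n (Sum.inl i) ∈ N) : gen K n (Sum.inl i) ∈ N := by
  rcases exists_pow_mem_le_two hN h0 i with h | h | h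
  · have h1 := hp 1 h (by simp [mem_part_zero])
    rw [mul_one, one_mul, ← two_smul K] at h1
    exact (N.smul_mem_iff two_ne_zero).1 h1
  · exact h
  · have h1 := hp _ h (by simp [mem_part_zero, parity_gen])
    rw [← pow_succ, ← pow_succ', ← two_smul K] at h1
    simpa using pow_add_one_mem hN i (m := 0) ((N.smul_mem_iff two_ne_zero).1 h1)

theorem part_one_le [CharZero K] {N : Submodule K (WeylAlgebra K n)}
    (hN : ∀ F ∈ part K n 0, ∀ x ∈ N, adLie K n F x ∈ N) (a : Fin n ⊕ Fin n)
    (ha : gen K n a ∈ N) : part K n 1 ≤ N := by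
  intro x hx
  obtain ⟨y, hy, rfl⟩ := exists_even_adLie_gen_eq a hx
  rw [adLie_apply, ← neg_sub, ← adLie_apply, neg_mem_iff]
  exact hN y hy _ ha

/-- The proof is by induction on the word length: `gen a * x` is half the sum of the anticommutator
and the commutator of `gen a` and `x`, and the latter is of smaller degree. -/
theorem codisjoint_scalars [CharZero K] {N : Submodule K (WeylAlgebra K n)}
    (h1 : part K n 1 ≤ N)
    (h : ∀ a, ∀ x ∈ part K n 1, gen K n a * x + x * gen K n a ∈ N) :
    scalars K n ⊔ N = ⊤ := by
  have key : ∀ d, filtration K n d ≤ scalars K n ⊔ N := by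
    intro d
    induction d with
    | zero => rw [filtration_zero]; exact le_sup_left
    | succ d ih =>
      refine filtration_succ_le ih fun a x hx => ?_
      obtain ⟨y, hy, z, hz, hyz⟩ := exists_add_mem_part x
      have hmem : gen K n a * x + x * gen K n a ∈ scalars K n ⊔ N := by
        refine Submodule.mem_sup_right ?_
        have hsplit : gen K n a * x + x * gen K n a =
            (gen K n a * y + y * gen K n a) + (gen K n a * z + z * gen K n a) := by
          rw [← hyz]
          noncomm_ring
        rw [hsplit]
        exact add_mem (h1 (mul_add_mul_mem_part.1 (gen_mem_part_one a) hy)) (h a z hz)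
      have hlow := ih (adLie_gen_mem_filtration a (filtration_mono (Nat.le_succ d) hx))
      refine (Submodule.smul_mem_iff _ (two_ne_zero (α := K))).1 ?_
      convert add_mem hmem hlow using 1
      rw [adLie_apply, two_smul]
      abel
  refine eq_top_iff.2 fun x _ => ?_
  obtain ⟨d, hd⟩ := exists_mem_filtration x
  exact key d hd

theorem disjoint_scalars_ker_supertrace [CharZero K] :
    Disjoint (scalars K n) (LinearMap.ker (supertrace K n)) := by
  rw [Submodule.disjoint_def]
  rintro _ ⟨c, rfl⟩ hc
  rw [Algebra.linearMap_apply, LinearMap.mem_ker, supertrace_algebraMap] at hc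
  rw [hc, map_zero]

theorem eq_ker_supertrace [CharZero K] {N : Submodule K (WeylAlgebra K n)}
    (h : N ≤ LinearMap.ker (supertrace K n)) (htop : scalars K n ⊔ N = ⊤) :
    N = LinearMap.ker (supertrace K n) :=
  eq_of_le_of_inf_le_of_sup_le (z := scalars K n) h
    (by rw [inf_comm, disjoint_scalars_ker_supertrace.eq_bot]; exact bot_le)
    (by rw [sup_comm N, htop]; exact le_top)

theorem adSuper_mem_superDerived (F G : WeylAlgebra K n) :
    adSuper K n F G ∈ superDerived K n :=
  Submodule.subset_span ⟨F, G, rfl⟩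

theorem superDerived_le_ker_supertrace [CharZero K] :
    superDerived K n ≤ LinearMap.ker (supertrace K n) := by
  refine Submodule.span_le.2 ?_
  rintro _ ⟨F, G, rfl⟩
  obtain ⟨F0, hF0, F1, hF1, rfl⟩ := exists_add_mem_part F
  obtain ⟨G0, hG0, G1, hG1, rfl⟩ := exists_add_mem_part G
  rw [map_add (adSuper K n), LinearMap.add_apply, map_add, map_add]
  refine add_mem (add_mem ?_ ?_) (add_mem ?_ ?_)
  · rw [adSuper_of_mem_part_zero hF0, LinearMap.mem_ker, map_sub, supertrace_mul,
      mem_part_zero.1 hF0, sub_self]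
  · exact supertrace_of_mem_part_one ((isSuperRep_adSuper.1) 0 1 _ hF0 _ hG1)
  · exact supertrace_of_mem_part_one ((isSuperRep_adSuper.1) 1 0 _ hF1 _ hG0)
  · rw [adSuper_of_mem_part_one hF1, LinearMap.mem_ker, map_sub, supertrace_mul,
      mem_part_one.1 hF1, mem_part_one.1 hG1, neg_mul, mul_neg, sub_self]

theorem superDerived_eq_ker_supertrace [CharZero K] (i : Fin n) :
    superDerived K n = LinearMap.ker (supertrace K n) := by
  refine eq_ker_supertrace superDerived_le_ker_supertrace (codisjoint_scalars ?_ ?_)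
  · intro x hx
    obtain ⟨y, hy, rfl⟩ := exists_even_adLie_gen_eq (Sum.inl i) hx
    have h := adSuper_mem_superDerived (gen K n (Sum.inl i)) y
    rwa [adSuper_of_mem_part_one (gen_mem_part_one _), mem_part_zero.1 hy] at h
  · intro a x hx
    have h := adSuper_mem_superDerived (gen K n a) x
    rwa [adSuper_of_mem_part_one (gen_mem_part_one _), mem_part_one.1 hx, neg_mul,
      sub_neg_eq_add] at h

theorem isCompl_scalars_superDerived [CharZero K] (i : Fin n) :
    IsCompl (scalars K n) (superDerived K n) := by
  rw [superDerived_eq_ker_supertrace i]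
  refine ⟨disjoint_scalars_ker_supertrace, codisjoint_iff.2 (eq_top_iff.2 fun x _ => ?_)⟩
  refine Submodule.mem_sup.2 ⟨algebraMap K _ (supertrace K n x), ⟨_, rfl⟩,
    x - algebraMap K _ (supertrace K n x), ?_, add_sub_cancel _ _⟩
  rw [LinearMap.mem_ker, map_sub, supertrace_algebraMap, sub_self]

theorem one_notMem_superDerived [CharZero K] : (1 : WeylAlgebra K n) ∉ superDerived K n := by
  intro h
  have h' := superDerived_le_ker_supertrace h
  rw [LinearMap.mem_ker, ← map_one (algebraMap K _), supertrace_algebraMap] at h'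
  exact one_ne_zero h'

theorem bot_lt_superDerived [CharZero K] (i : Fin n) :
    (⊥ : Submodule K (WeylAlgebra K n)) < superDerived K n := by
  refine bot_lt_iff_ne_bot.2 fun h => ?_
  have hp : gen K n (Sum.inl i) ∈ superDerived K n := by
    rw [superDerived_eq_ker_supertrace i]
    exact supertrace_of_mem_part_one (gen_mem_part_one _)
  rw [h, Submodule.mem_bot] at hp
  exact gen_notMem_scalars (Sum.inl i) (by rw [hp]; exact zero_mem _)

theorem adLieTwisted_mem_superDerived [CharZero K] (i : Fin n) (F G : WeylAlgebra K n) :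
    adLieTwisted K n F G ∈ superDerived K n := by
  rw [superDerived_eq_ker_supertrace i, LinearMap.mem_ker, adLieTwisted_apply, map_sub,
    supertrace_mul, sub_self]

theorem adLieTwisted_of_mem_part_zero [CharZero K] {F : WeylAlgebra K n} (hF : F ∈ part K n 0)
    (G : WeylAlgebra K n) : adLieTwisted K n F G = adLie K n F G := by
  rw [adLieTwisted_apply, mem_part_zero.1 hF, adLie_apply]

theorem adLieTwisted_of_mem_part_one [CharZero K] {F : WeylAlgebra K n} (hF : F ∈ part K n 1)
    (G : WeylAlgebra K n) : adLieTwisted K n F G = F * G + G * F := by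
  rw [adLieTwisted_apply, mem_part_one.1 hF, mul_neg, sub_neg_eq_add]

theorem gen_inl_mem_of_isSubrep_adLieTwisted [CharZero K] {N : Submodule K (WeylAlgebra K n)}
    (hN : IsSubrep (adLieTwisted K n) N) (h0 : N ≠ ⊥) (i : Fin n) : gen K n (Sum.inl i) ∈ N := by
  refine gen_inl_mem (fun F hF x hx => ?_) h0 i fun x hx _ => ?_
  · rw [← adLieTwisted_of_mem_part_zero hF]
    exact hN F x hx
  · rw [← adLieTwisted_of_mem_part_one (gen_mem_part_one _)]
    exact hN _ x hx

theorem isSimpleSubrep_adLieTwisted [CharZero K] (i : Fin n) :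
    IsSimpleSubrep (adLieTwisted K n) (superDerived K n) := by
  refine ⟨fun F x hx => ?_, fun F x _ => adLieTwisted_mem_superDerived i F x,
    bot_lt_superDerived i, fun N hN _ hle => ?_⟩
  · rw [(Submodule.mem_bot K).1 hx, map_zero]
    exact zero_mem _
  · by_cases h0 : N = ⊥
    · exact Or.inl h0
    right
    rw [superDerived_eq_ker_supertrace i] at hle ⊢
    have hodd : part K n 1 ≤ N := part_one_le (fun F hF x hx => by
      rw [← adLieTwisted_of_mem_part_zero hF]
      exact hN F x hx) _ (gen_inl_mem_of_isSubrep_adLieTwisted hN h0 i)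
    refine eq_ker_supertrace hle (codisjoint_scalars hodd fun a x hx => ?_)
    rw [add_comm, ← adLieTwisted_of_mem_part_one hx]
    exact hN x _ (hodd (gen_mem_part_one a))

theorem isIndecomposableRep_adLieTwisted [CharZero K] (i : Fin n) :
    IsIndecomposableRep (adLieTwisted K n) := by
  refine ⟨inferInstance, fun U V hU hV hUV => ?_⟩
  by_contra! h
  have h0 := Submodule.disjoint_def.1 hUV.disjoint _
    (gen_inl_mem_of_isSubrep_adLieTwisted hU h.1 i) (gen_inl_mem_of_isSubrep_adLieTwisted hV h.2 i)
  exact gen_notMem_scalars (K := K) (Sum.inl i) (by rw [h0]; exact zero_mem _)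

theorem finrank_quotient_superDerived [CharZero K] (i : Fin n) :
    Module.finrank K (WeylAlgebra K n ⧸ superDerived K n) = 1 := by
  rw [(Submodule.quotientEquivOfIsCompl _ _ (isCompl_scalars_superDerived i).symm).finrank_eq,
    scalars_eq_span]
  exact finrank_span_singleton one_ne_zero

/-- The cocycle `F ↦ F - σ(F)`, with `σ` the parity automorphism. On `W` it is the coboundary of
`1`, which does not lie in `[W, W]`. -/
noncomputable def parityCocycle [CharZero K] (i : Fin n) : WeylAlgebra K n →ₗ[K] superDerived K n :=
  LinearMap.codRestrict _ ((adLieTwisted K n).flip 1)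
    fun F => adLieTwisted_mem_superDerived i F 1

theorem parityCocycle_apply [CharZero K] (i : Fin n) (F : WeylAlgebra K n) :
    (parityCocycle i F : WeylAlgebra K n) = adLieTwisted K n F 1 := rfl

theorem isLieCocycle_parityCocycle [CharZero K] (i : Fin n) :
    IsLieCocycle (adLieTwisted K n) (superDerived K n) (parityCocycle i) := fun F G => by
  simp only [parityCocycle_apply, isLieRep_adLieTwisted F G, LinearMap.sub_apply,
    Module.End.mul_apply]

/-- If the cocycle were the coboundary of `H` in `[W, W]`, then `H - 1` would be annihilated by the
twisted action. A nonzero vector of this kind spans a subrepresentation, which contains `p_i`, but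
`p_i` acts on itself by `2 p_i ^ 2`, which is not `0`. -/
theorem not_isLieCoboundary_parityCocycle [CharZero K] (i : Fin n) :
    ¬ IsLieCoboundary (adLieTwisted K n) (superDerived K n) (parityCocycle i) := by
  rintro ⟨H, hH, h⟩
  have hker : ∀ F, adLieTwisted K n F (H - 1) = 0 := fun F => by
    rw [map_sub, ← h F, parityCocycle_apply, sub_self]
  have hzero : H - 1 = 0 := by
    by_contra h0
    have hp := gen_inl_mem_of_isSubrep_adLieTwisted (N := K ∙ (H - 1)) (fun F x hx => by
      obtain ⟨c, rfl⟩ := Submodule.mem_span_singleton.1 hx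
      rw [map_smul, hker, smul_zero]
      exact zero_mem _) (by rwa [Ne, Submodule.span_singleton_eq_bot]) i
    obtain ⟨c, hc⟩ := Submodule.mem_span_singleton.1 hp
    have h1 := hker (gen K n (Sum.inl i))
    have h2 : adLieTwisted K n (gen K n (Sum.inl i)) (gen K n (Sum.inl i)) = 0 := by
      conv_lhs => enter [2]; rw [← hc]
      rw [map_smul, h1, smul_zero]
    rw [adLieTwisted_of_mem_part_one (gen_mem_part_one _)] at h2
    exact gen_notMem_scalars (K := K) (Sum.inl i)
      (by rw [eq_zero_of_gen_mul_add_mul_gen_eq_zero _ h2]; exact zero_mem _)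
  rw [sub_eq_zero.1 hzero] at hH
  exact one_notMem_superDerived hH

theorem isSubrep_scalars_adSuper [CharZero K] : IsSubrep (adSuper K n) (scalars K n) := by
  rintro F _ ⟨c, rfl⟩
  obtain ⟨F0, hF0, F1, hF1, rfl⟩ := exists_add_mem_part F
  rw [map_add, LinearMap.add_apply, adSuper_of_mem_part_zero hF0, adSuper_of_mem_part_one hF1,
    Algebra.linearMap_apply, AlgHom.commutes, Algebra.commutes, Algebra.commutes c F1, sub_self,
    sub_self, add_zero]
  exact zero_mem _

theorem isSimpleSubrep_adSuper [CharZero K] (i : Fin n) :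
    IsSimpleSubrep (adSuper K n) (superDerived K n) := by
  refine ⟨fun F x hx => ?_, fun F x _ => adSuper_mem_superDerived F x,
    bot_lt_superDerived i, fun N hN _ hle => ?_⟩
  · rw [(Submodule.mem_bot K).1 hx, map_zero]
    exact zero_mem _
  · by_cases h0 : N = ⊥
    · exact Or.inl h0
    right
    have heven : ∀ F ∈ part K n 0, ∀ x ∈ N, adLie K n F x ∈ N := fun F hF x hx => by
      rw [adLie_apply, ← adSuper_of_mem_part_zero hF]
      exact hN F x hx
    have hp : gen K n (Sum.inl i) ∈ N := by
      rcases exists_pow_mem_le_two heven h0 i with h | h | h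
      · exact absurd (hle h) one_notMem_superDerived
      · exact h
      · have h1 := hN (gen K n (Sum.inr i)) _ h
        rw [adSuper_of_mem_part_one (gen_mem_part_one _), map_pow, parity_gen, neg_sq,
          gen_inr_mul_sub_gen_inl_sq_mul] at h1
        exact (N.smul_mem_iff (neg_ne_zero.2 two_ne_zero)).1 h1
    have hodd := part_one_le heven _ hp
    rw [superDerived_eq_ker_supertrace i] at hle ⊢
    refine eq_ker_supertrace hle (codisjoint_scalars hodd fun a x hx => ?_)
    have h1 := hN x _ (hodd (gen_mem_part_one a))
    rwa [adSuper_of_mem_part_one hx, parity_gen, neg_mul, sub_neg_eq_add, add_comm] at h1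

theorem isSimpleSubrep_adSuperTwisted [CharZero K] (i : Fin n) :
    IsSimpleSubrep (adSuperTwisted K n) ⊤ := by
  refine ⟨fun F x hx => ?_, fun F x _ => Submodule.mem_top, bot_lt_top, fun N hN _ _ => ?_⟩
  · rw [(Submodule.mem_bot K).1 hx, map_zero]
    exact zero_mem _
  · by_cases h0 : N = ⊥
    · exact Or.inl h0
    right
    have heven : ∀ F ∈ part K n 0, ∀ x ∈ N, adLie K n F x ∈ N := fun F hF x hx => by
      rw [adLie_apply, ← adSuperTwisted_of_mem_part_zero hF]
      exact hN F x hx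
    have hp : gen K n (Sum.inl i) ∈ N := gen_inl_mem heven h0 i fun x hx hx0 => by
      have h1 := hN (gen K n (Sum.inl i)) x hx
      rwa [adSuperTwisted_of_mem_part_one (gen_mem_part_one _), mem_part_zero.1 hx0] at h1
    have hodd := part_one_le heven _ hp
    refine eq_top_iff.2 fun x _ => ?_
    obtain ⟨y, hy, z, hz, rfl⟩ := exists_add_mem_part x
    refine add_mem ?_ (hodd hz)
    obtain ⟨w, hw, rfl⟩ := exists_odd_adLie_gen_eq (Sum.inl i) hy
    have h1 := hN w _ hp
    rw [adSuperTwisted_of_mem_part_one hw, parity_gen, neg_mul, ← sub_eq_add_neg] at h1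
    rwa [adLie_apply, ← neg_sub, neg_mem_iff]

end WeylAlgebra

theorem theorem3p7 (K : Type*) [Field K] [CharZero K] (n : ℕ) (hn : 1 ≤ n) :
    -- (1) the adjoint representation of the Lie algebra `W`
    (IsLieRep (WeylAlgebra.adLie K n) ∧
      IsIndecomposableRep (WeylAlgebra.adLie K n) ∧
      IsSimpleSubquotient (WeylAlgebra.adLie K n) ⊥ (WeylAlgebra.scalars K n) ∧
      IsSimpleSubquotient (WeylAlgebra.adLie K n) (WeylAlgebra.scalars K n) ⊤ ∧
      Submodule.span K {H | ∃ F G : WeylAlgebra K n, H = WeylAlgebra.adLie K n F G} = ⊤) ∧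
    -- (2) the twisted adjoint representation of the Lie algebra `W`
    (IsLieRep (WeylAlgebra.adLieTwisted K n) ∧
      IsIndecomposableRep (WeylAlgebra.adLieTwisted K n) ∧
      IsSimpleSubrep (WeylAlgebra.adLieTwisted K n) (WeylAlgebra.superDerived K n) ∧
      Module.finrank K (WeylAlgebra K n ⧸ WeylAlgebra.superDerived K n) = 1 ∧
      (∀ F G : WeylAlgebra K n,
        WeylAlgebra.adLieTwisted K n F G ∈ WeylAlgebra.superDerived K n) ∧
      ∃ ξ : WeylAlgebra K n →ₗ[K] WeylAlgebra.superDerived K n,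
        (∀ F ∈ WeylAlgebra.part K n 0, ξ F = 0) ∧
        (∀ F ∈ WeylAlgebra.part K n 1, (ξ F : WeylAlgebra K n) = (2 : K) • F) ∧
        IsLieCocycle (WeylAlgebra.adLieTwisted K n) (WeylAlgebra.superDerived K n) ξ ∧
        ¬ IsLieCoboundary (WeylAlgebra.adLieTwisted K n) (WeylAlgebra.superDerived K n) ξ) ∧
    -- (3) the adjoint representation of the Lie superalgebra `W`
    (WeylAlgebra.IsSuperRep (WeylAlgebra.adSuper K n) ∧
      IsSimpleSubrep (WeylAlgebra.adSuper K n) (WeylAlgebra.superDerived K n) ∧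
      IsSubrep (WeylAlgebra.adSuper K n) (WeylAlgebra.scalars K n) ∧
      IsCompl (WeylAlgebra.scalars K n) (WeylAlgebra.superDerived K n)) ∧
    -- (4) the twisted adjoint representation of the Lie superalgebra `W`
    (WeylAlgebra.IsSuperRep (WeylAlgebra.adSuperTwisted K n) ∧
      IsSimpleSubrep (WeylAlgebra.adSuperTwisted K n) ⊤) := by
  have i : Fin n := ⟨0, hn⟩
  have hbot : IsSubrep (WeylAlgebra.adLie K n) ⊥ := fun F x hx => by
    rw [(Submodule.mem_bot K).1 hx, map_zero]
    exact zero_mem _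
  refine ⟨⟨WeylAlgebra.isLieRep_adLie, WeylAlgebra.isIndecomposableRep_adLie,
      ⟨hbot, WeylAlgebra.isSubrep_scalars_adLie, WeylAlgebra.bot_lt_scalars,
        fun N _ _ hle => WeylAlgebra.eq_bot_or_eq_of_le_scalars hle⟩,
      ⟨WeylAlgebra.isSubrep_scalars_adLie, fun _ _ _ => Submodule.mem_top,
        WeylAlgebra.scalars_lt_top i, fun N hN hle _ => ?_⟩, ?_⟩,
    ⟨WeylAlgebra.isLieRep_adLieTwisted, WeylAlgebra.isIndecomposableRep_adLieTwisted i,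
      WeylAlgebra.isSimpleSubrep_adLieTwisted i, WeylAlgebra.finrank_quotient_superDerived i,
      WeylAlgebra.adLieTwisted_mem_superDerived i, WeylAlgebra.parityCocycle i, fun F hF => ?_,
      fun F hF => ?_, WeylAlgebra.isLieCocycle_parityCocycle i,
      WeylAlgebra.not_isLieCoboundary_parityCocycle i⟩,
    ⟨WeylAlgebra.isSuperRep_adSuper, WeylAlgebra.isSimpleSubrep_adSuper i,
      WeylAlgebra.isSubrep_scalars_adSuper, WeylAlgebra.isCompl_scalars_superDerived i⟩,
    WeylAlgebra.isSuperRep_adSuperTwisted, WeylAlgebra.isSimpleSubrep_adSuperTwisted i⟩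
  · by_cases h : N ≤ WeylAlgebra.scalars K n
    · exact Or.inl (le_antisymm h hle)
    · exact Or.inr (WeylAlgebra.eq_top_of_not_le_scalars hN h)
  · refine eq_top_iff.2 fun x _ => ?_
    obtain ⟨y, rfl⟩ := WeylAlgebra.exists_adLie_gen_eq (Sum.inl i) x
    exact Submodule.subset_span ⟨_, y, rfl⟩
  · refine Subtype.ext ?_
    rw [WeylAlgebra.parityCocycle_apply, WeylAlgebra.adLieTwisted_of_mem_part_zero hF,
      WeylAlgebra.adLie_apply, mul_one, one_mul, sub_self]
    rfl
  · rw [WeylAlgebra.parityCocycle_apply, WeylAlgebra.adLieTwisted_of_mem_part_one hF, mul_one,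
      one_mul, two_smul]
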